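/- Let $H$ be a separable infinite-dimensional complex Hilbert space (inner product linear in the second variable). Let $\mathrm{SA}(H)$ be the set of all (not necessarily bounded) self-adjoint operators on $H$ with the strong resolvent topology, i.e. the coarsest topology making $A\mapsto (A-i)^{-1}$ continuous into the bounded operators with the strong operator topology. This is a Polish space. Let $E_{\mathrm{dom}}$ be the equivalence relation on $\mathrm{SA}(H)$ given by $A\,E_{\mathrm{dom}}\,B\iff \mathrm{dom}(A)=\mathrm{dom}(B)$, and let $E_{\ell^\infty}$ be the equivalence relation on $\mathbb{R}^{\mathbb{N}}$ (product topology) given by $(a_n)\,E_{\ell^\infty}\,(b_n)\iff \sup_n|a_n-b_n|<\infty$. For equivalence relations $E$ on $X$ and $F$ on $Y$, a continuous reduction of $E$ to $F$ is a continuous map $f\colon X\to Y$ with $x\,E\,y\iff f(x)\,F\,f(y)$ for all $x,y\in X$; $E$ and $F$ are continuously bireducible if there are continuous reductions of $E$ to $F$ and of $F$ to $E$. Then $E_{\mathrm{dom}}$ is an $F_\sigma$ subset of $\mathrm{SA}(H)\times \mathrm{SA}(H)$, and $E_{\mathrm{dom}}$ and $E_{\ell^\infty}$ are continuously bireducible.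 More explicitly: (1) for every dense sequence $(\xi_n)_{n\ge 1}$ of nonzero vectors of $H$, one has $\langle \xi_n,(|A|+1)^{-2}\xi_n\rangle>0$ for all $A\in \mathrm{SA}(H)$ and all $n$, and $A\mapsto \big(\log\langle \xi_n,(|A|+1)^{-2}\xi_n\rangle\big)_n$ is a continuous reduction of $E_{\mathrm{dom}}$ to $E_{\ell^\infty}$; (2) for every orthonormal basis $(\eta_n)_{n\ge 1}$ of $H$, the map sending $x=(x_n)_{n\ge 1}\in\mathbb{R}^{\mathbb{N}}$ to the self-adjoint diagonal operator $\sum_n(\exp(\tilde x_n/2)-1)\langle \eta_n,\cdot\rangle\eta_n$ (with its maximal domain) is a continuous reduction of $E_{\ell^\infty}$ to $E_{\mathrm{dom}}$, where $(\tilde x_{2n-1},\tilde x_{2n})=(|x_n|,0)$ if $x_n\ge 0$ and $(\tilde x_{2n-1},\tilde x_{2n})=(0,|x_n|)$ if $x_n<0$. -/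

import Mathlib

set_option linter.unusedSectionVars false

open scoped InnerProductSpace
open Topology

noncomputable section

namespace DomainEquivalence

variable {H : Type*} [NormedAddCommGroup H] [InnerProductSpace ℂ H]

/-! ### Bounded inverses of unbounded operators -/

/-- The operator `T + z`, with the same domain as `T`. -/
def addScalar (T : H →ₗ.[ℂ] H) (z : ℂ) : H →ₗ.[ℂ] H :=
  (z • (LinearMap.id : H →ₗ[ℂ] H)) +ᵥ T

/-- `R` is the everywhere defined bounded inverse `T⁻¹` of the unbounded operator `T`:
for every `x`, the vector `R x` lies in the domain of `T` and `T (R x) = x`;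
and `R (T y) = y` for every `y` in the domain of `T`. -/
def IsBoundedInverse (T : H →ₗ.[ℂ] H) (R : H →L[ℂ] H) : Prop :=
  (∀ x : H, (R x, x) ∈ T.graph) ∧ ∀ y : T.domain, R (T y) = y

theorem IsBoundedInverse.unique {T : H →ₗ.[ℂ] H} {R S : H →L[ℂ] H}
    (hR : IsBoundedInverse T R) (hS : IsBoundedInverse T S) : R = S := by
  ext x
  obtain ⟨y, h1, h2⟩ := (LinearPMap.mem_graph_iff T).1 (hR.1 x)
  have := hS.2 y
  simp only at h1 h2
  rw [h2] at this
  rw [this, h1]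

theorem symmetric_of_isSelfAdjoint [CompleteSpace H] {A : H →ₗ.[ℂ] H} (hA : IsSelfAdjoint A)
    (x y : A.domain) : ⟪A x, (y : H)⟫_ℂ = ⟪(x : H), A y⟫_ℂ := by
  have h := LinearPMap.adjoint_isFormalAdjoint hA.dense_domain
  rw [LinearPMap.isSelfAdjoint_def.1 hA] at h
  exact h x y

theorem mem_graph_of_isSelfAdjoint [CompleteSpace H] {A : H →ₗ.[ℂ] H} (hA : IsSelfAdjoint A)
    {y w : H} (h : ∀ x : A.domain, ⟪w, (x : H)⟫_ℂ = ⟪y, A x⟫_ℂ) : (y, w) ∈ A.graph := by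
  have hy := LinearPMap.mem_adjoint_domain_of_exists (T := A) y ⟨w, h⟩
  have h2 := LinearPMap.adjoint_apply_eq hA.dense_domain ⟨y, hy⟩ h
  have h3 : (y, w) ∈ A.adjoint.graph := (LinearPMap.mem_graph_iff _).2 ⟨⟨y, hy⟩, rfl, h2⟩
  rwa [LinearPMap.isSelfAdjoint_def.1 hA] at h3

theorem isSelfAdjoint_of_symmetric [CompleteSpace H] {A : H →ₗ.[ℂ] H}
    (hd : Dense (A.domain : Set H))
    (hs : ∀ x y : A.domain, ⟪A x, (y : H)⟫_ℂ = ⟪(x : H), A y⟫_ℂ)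
    (h : ∀ y w : H, (∀ x : A.domain, ⟪w, (x : H)⟫_ℂ = ⟪y, A x⟫_ℂ) → (y, w) ∈ A.graph) :
    IsSelfAdjoint A := by
  rw [LinearPMap.isSelfAdjoint_def]
  apply le_antisymm
  · apply LinearPMap.le_of_le_graph
    rintro ⟨y, w⟩ hyw
    obtain ⟨y', h1, h2⟩ := (LinearPMap.mem_graph_iff _).1 hyw
    simp only at h1 h2
    subst h1 h2
    exact h _ _ fun x => LinearPMap.adjoint_isFormalAdjoint hd y' x
  · exact LinearPMap.IsFormalAdjoint.le_adjoint hd (fun x y => hs x y)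

theorem exists_isBoundedInverse [CompleteSpace H] {A : H →ₗ.[ℂ] H} (hA : IsSelfAdjoint A)
    (z : ℂ) (h1 : ∀ x : A.domain, ‖(x : H)‖ ≤ ‖z • (x : H) + A x‖)
    (h2 : ∀ x : A.domain, ‖(x : H)‖ ≤ ‖star z • (x : H) + A x‖) :
    ∃ R : H →L[ℂ] H, IsBoundedInverse (addScalar A z) R := by
  let T : A.domain →ₗ[ℂ] H := (addScalar A z).toFun
  have hT : ∀ x : A.domain, T x = z • (x : H) + A x := fun x => rfl
  have hclosed : IsClosed (A.graph : Set (H × H)) := hA.isClosed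
  have : CompleteSpace A.graph := hclosed.completeSpace_coe
  let G : A.graph →L[ℂ] H :=
    (z • ContinuousLinearMap.fst ℂ H H + ContinuousLinearMap.snd ℂ H H).comp A.graph.subtypeL
  have hG : ∀ p : A.graph, ‖p‖ ≤ (1 + ‖z‖) * ‖G p‖ := by
    rintro ⟨⟨x, y⟩, hp⟩
    obtain ⟨x', e1, e2⟩ := (LinearPMap.mem_graph_iff _).1 hp
    simp only at e1 e2
    subst e1 e2
    have hGv : G ⟨(↑x', A x'), hp⟩ = z • (x' : H) + A x' := rfl
    have hx := h1 x'
    rw [hGv]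
    have hy : ‖A x'‖ ≤ ‖z • (x' : H) + A x'‖ + ‖z‖ * ‖(x' : H)‖ := by
      rw [← norm_smul]
      calc ‖A x'‖ = ‖(z • (x' : H) + A x') - z • (x' : H)‖ := by rw [add_sub_cancel_left]
        _ ≤ _ := norm_sub_le _ _
    have hz := norm_nonneg z
    change max ‖(x' : H)‖ ‖A x'‖ ≤ _
    apply max_le
    · nlinarith [norm_nonneg (x' : H)]
    · nlinarith [norm_nonneg (x' : H), mul_le_mul_of_nonneg_left hx hz]
  have hrc : IsClosed (Set.range G) := by
    have : AntilipschitzWith ⟨1 + ‖z‖, by positivity⟩ G :=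
      ContinuousLinearMap.antilipschitz_of_bound G hG
    exact this.isClosed_range G.uniformContinuous
  have hrange : Set.range G = (LinearMap.range T : Set H) := by
    ext v
    constructor
    · rintro ⟨⟨⟨x, y⟩, hp⟩, rfl⟩
      obtain ⟨x', e1, e2⟩ := (LinearPMap.mem_graph_iff _).1 hp
      simp only at e1 e2
      subst e1 e2
      exact ⟨x', rfl⟩
    · rintro ⟨x, rfl⟩
      exact ⟨⟨(↑x, A x), LinearPMap.mem_graph A x⟩, rfl⟩
  rw [hrange] at hrc
  have hsurj : LinearMap.range T = ⊤ := by
    have : CompleteSpace (LinearMap.range T) := hrc.completeSpace_coe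
    rw [← Submodule.orthogonal_eq_bot_iff, Submodule.eq_bot_iff]
    intro y hy
    have hmem : (y, -(star z • y)) ∈ A.graph := by
      apply mem_graph_of_isSelfAdjoint hA
      intro x
      have := (Submodule.mem_orthogonal' _ _).1 hy (T x) ⟨x, rfl⟩
      rw [hT, inner_add_right, inner_smul_right] at this
      rw [inner_neg_left, inner_smul_left]
      simp only [Complex.star_def, Complex.conj_conj]
      linear_combination -this
    obtain ⟨y', e1, e2⟩ := (LinearPMap.mem_graph_iff _).1 hmem
    simp only at e1 e2
    have := h2 y'
    rw [e2, e1] at this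
    simpa using this
  have hinj : Function.Injective T := by
    rw [← LinearMap.ker_eq_bot, LinearMap.ker_eq_bot']
    intro x hx
    have := h1 x
    rw [← hT, hx] at this
    simpa using this
  let e : A.domain ≃ₗ[ℂ] H := LinearEquiv.ofBijective T ⟨hinj, LinearMap.range_eq_top.1 hsurj⟩
  have he : ∀ x, e x = T x := fun x => rfl
  let R : H →L[ℂ] H := LinearMap.mkContinuous (A.domain.subtype ∘ₗ e.symm.toLinearMap) 1 (by
    intro x
    have := h1 (e.symm x)
    rw [← hT, ← he, e.apply_symm_apply] at this
    simpa using this)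
  have hR : ∀ x, R x = (e.symm x : H) := fun x => rfl
  refine ⟨R, fun x => ?_, fun y => ?_⟩
  · refine (LinearPMap.mem_graph_iff _).2 ⟨e.symm x, rfl, ?_⟩
    exact e.apply_symm_apply x
  · rw [hR]
    exact congrArg Subtype.val (e.symm_apply_apply y)

/-! ### Self-adjoint operators and the strong resolvent topology -/

variable (H) in
/-- `SA H`: the set of all (not necessarily bounded, densely defined) self-adjoint operators on the
Hilbert space `H`. -/
def SA [CompleteSpace H] : Type _ := {A : H →ₗ.[ℂ] H // IsSelfAdjoint A}

variable [CompleteSpace H]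

/-- The domain of a self-adjoint operator. -/
def SA.dom (A : SA H) : Submodule ℂ H := A.1.domain

theorem SA.norm_sq_add_I (A : SA H) (s : ℝ) (x : A.1.domain) :
    ‖((s : ℂ) * Complex.I) • (x : H) + A.1 x‖ ^ 2 = s ^ 2 * ‖(x : H)‖ ^ 2 + ‖A.1 x‖ ^ 2 := by
  have h := symmetric_of_isSelfAdjoint A.2 x x
  have hre : (⟪((s : ℂ) * Complex.I) • (x : H), A.1 x⟫_ℂ).re = 0 := by
    have him : (⟪(x : H), A.1 x⟫_ℂ).im = 0 := by
      rw [← inner_conj_symm] at h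
      have := congrArg Complex.im h
      simp only [Complex.conj_im] at this
      linarith
    rw [inner_smul_left]
    simp [him]
  rw [norm_add_sq (𝕜 := ℂ)]
  simp only [RCLike.re_to_complex, hre, norm_smul, norm_mul, Complex.norm_I, Complex.norm_real,
    Real.norm_eq_abs, mul_one, mul_pow, sq_abs]
  ring

theorem SA.exists_resolvent (A : SA H) :
    ∃ R : H →L[ℂ] H, IsBoundedInverse (addScalar A.1 (-Complex.I)) R := by
  apply exists_isBoundedInverse A.2
  · intro x
    have := A.norm_sq_add_I (-1) x
    refine le_of_sq_le_sq ?_ (norm_nonneg _)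
    simp only [Complex.ofReal_neg, Complex.ofReal_one, neg_mul, one_mul] at this
    rw [this]
    nlinarith [sq_nonneg ‖A.1 x‖]
  · intro x
    have := A.norm_sq_add_I 1 x
    refine le_of_sq_le_sq ?_ (norm_nonneg _)
    simp only [Complex.ofReal_one, one_mul] at this
    simp only [star_neg, Complex.star_def, Complex.conj_I, neg_neg]
    rw [this]
    nlinarith [sq_nonneg ‖A.1 x‖]

/-- The resolvent `(A - i)⁻¹`, a bounded operator on `H`. -/
def SA.resolvent (A : SA H) : H →L[ℂ] H := A.exists_resolvent.choose

theorem SA.resolvent_spec (A : SA H) :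
    IsBoundedInverse (addScalar A.1 (-Complex.I)) A.resolvent := A.exists_resolvent.choose_spec

/-- The strong resolvent topology on `SA H`: the coarsest topology making `A ↦ (A - i)⁻¹`
continuous for the strong operator topology (pointwise convergence) on the bounded operators. -/
instance : TopologicalSpace (SA H) :=
  TopologicalSpace.induced
    (fun A => ContinuousLinearMap.toPointwiseConvergenceCLM ℂ (RingHom.id ℂ) H H A.resolvent)
    inferInstance

/-! ### The absolute value of a self-adjoint operator -/

/-- `x` lies in the domain of `T² = T ∘ T` (that is, `x` and `T x` lie in the domain of `T`), and
`T² x = y`. -/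
def SqRel (T : H →ₗ.[ℂ] H) (x y : H) : Prop := ∃ z, (x, z) ∈ T.graph ∧ (z, y) ∈ T.graph

/-- `P = |A|`: `P` is the positive self-adjoint operator with `P² = A²` as unbounded operators,
domains included. -/
def IsAbs (A P : H →ₗ.[ℂ] H) : Prop :=
  IsSelfAdjoint P ∧ (∀ x : P.domain, 0 ≤ (⟪(x : H), P x⟫_ℂ).re) ∧
    ∀ x y : H, SqRel P x y ↔ SqRel A x y

theorem exists_isAbs {A : H →ₗ.[ℂ] H} (hA : IsSelfAdjoint A) : ∃ P, IsAbs A P := by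
  obtain ⟨R, hR⟩ := SA.exists_resolvent ⟨A, hA⟩
  -- `R x` and `R† x` under `A`
  have hR1 : ∀ x, (R x, x + Complex.I • R x) ∈ A.graph := by
    intro x
    obtain ⟨u, e1, e2⟩ := (LinearPMap.mem_graph_iff _).1 (hR.1 x)
    refine (LinearPMap.mem_graph_iff _).2 ⟨u, e1, ?_⟩
    have e2' : (-Complex.I) • (u : H) + A u = x := e2
    simp only at e1
    rw [← e1, ← e2']
    module
  have hR2 : ∀ x, (star R x, x - Complex.I • star R x) ∈ A.graph := by
    intro x
    apply mem_graph_of_isSelfAdjoint hA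
    intro y
    have h1 : R ((-Complex.I) • (y : H) + A y) = y := hR.2 y
    have h2 : ⟪star R x, (-Complex.I) • (y : H) + A y⟫_ℂ = ⟪x, (y : H)⟫_ℂ := by
      rw [ContinuousLinearMap.star_eq_adjoint, ContinuousLinearMap.adjoint_inner_left, h1]
    rw [inner_add_right, inner_smul_right] at h2
    rw [inner_sub_left, inner_smul_left, ← h2]
    simp
  set K : H →L[ℂ] H := R * star R with hK
  have hKA : ∀ w, SqRel A (K w) (w - K w) := by
    intro w
    refine ⟨_, hR1 (star R w), ?_⟩
    have h3 := A.graph.add_mem (hR2 w) (A.graph.smul_mem Complex.I (hR1 (star R w)))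
    have hKw : K w = R (star R w) := rfl
    convert h3 using 1
    rw [Prod.smul_mk, Prod.mk_add_mk, hKw, smul_add, smul_smul, Complex.I_mul_I]
    congr 1
    module
  have hAK : ∀ x y, SqRel A x y → x = K (x + y) := by
    rintro x y ⟨z, h1, h2⟩
    obtain ⟨z', h1', h2'⟩ := hKA (x + y)
    have e1 := A.graph.sub_mem h1 h1'
    have e2 := A.graph.sub_mem h2 h2'
    rw [Prod.mk_sub_mk] at e1 e2
    have e3 : y - (x + y - K (x + y)) = -(x - K (x + y)) := by abel
    rw [e3] at e2
    obtain ⟨a, ha1, ha2⟩ := (LinearPMap.mem_graph_iff _).1 e1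
    obtain ⟨b, hb1, hb2⟩ := (LinearPMap.mem_graph_iff _).1 e2
    simp only at ha1 ha2 hb1 hb2
    have hs := symmetric_of_isSelfAdjoint hA a b
    rw [ha1, ha2, hb1, hb2, inner_neg_right, inner_self_eq_norm_sq_to_K,
      inner_self_eq_norm_sq_to_K] at hs
    have hs' := congrArg Complex.re hs
    rw [← RCLike.ofReal_pow, ← RCLike.ofReal_pow] at hs'
    simp only [Complex.coe_algebraMap, Complex.neg_re, Complex.ofReal_re] at hs'
    have : ‖x - K (x + y)‖ = 0 := by
      by_contra h
      have := sq_pos_of_ne_zero h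
      nlinarith [sq_nonneg ‖z - z'‖]
    exact sub_eq_zero.1 (norm_eq_zero.1 this)
  have hK0 : 0 ≤ K := mul_star_self_nonneg R
  have hRn : ‖R‖ ≤ 1 := by
    apply ContinuousLinearMap.opNorm_le_bound _ zero_le_one
    intro x
    obtain ⟨u, e1, e2⟩ := (LinearPMap.mem_graph_iff _).1 (hR.1 x)
    have e2' : (-Complex.I) • (u : H) + A u = x := e2
    simp only at e1
    have := SA.norm_sq_add_I ⟨A, hA⟩ (-1) u
    simp only [Complex.ofReal_neg, Complex.ofReal_one, neg_mul, one_mul] at this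
    rw [← e1, ← e2', one_mul]
    refine le_of_sq_le_sq ?_ (norm_nonneg _)
    rw [this]
    nlinarith [sq_nonneg ‖A u‖]
  have hK1 : 0 ≤ 1 - K := by
    rw [sub_nonneg, ← CStarAlgebra.norm_le_one_iff_of_nonneg K hK0]
    calc ‖K‖ ≤ ‖R‖ * ‖star R‖ := norm_mul_le _ _
      _ ≤ 1 * 1 := by
        rw [norm_star]
        exact mul_le_mul hRn hRn (norm_nonneg _) zero_le_one
      _ = 1 := one_mul 1
  set S : H →L[ℂ] H := CFC.sqrt K with hS
  set C : H →L[ℂ] H := CFC.sqrt (1 - K) with hC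
  have hSS : S * S = K := CFC.sqrt_mul_sqrt_self K hK0
  have hCC : C * C = 1 - K := CFC.sqrt_mul_sqrt_self (1 - K) hK1
  have hS0 : 0 ≤ S := CFC.sqrt_nonneg K
  have hC0 : 0 ≤ C := CFC.sqrt_nonneg (1 - K)
  have hcomm : Commute S C := by
    have h1 : Commute S (1 - K) := by
      rw [← hSS]
      exact (Commute.one_right S).sub_right ((Commute.refl S).mul_right (Commute.refl S))
    exact (h1.symm.cfcₙ_nnreal (NNReal.sqrt)).symm
  have hCS0 : 0 ≤ C * S := hcomm.symm.mul_nonneg hC0 hS0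
  have hSsa : ∀ x y, ⟪S x, y⟫_ℂ = ⟪x, S y⟫_ℂ :=
    ((ContinuousLinearMap.nonneg_iff_isPositive _).1 hS0).isSymmetric
  have hCsa : ∀ x y, ⟪C x, y⟫_ℂ = ⟪x, C y⟫_ℂ :=
    ((ContinuousLinearMap.nonneg_iff_isPositive _).1 hC0).isSymmetric
  have aSS : ∀ x, S (S x) = K x := fun x => congrArg (fun T : H →L[ℂ] H => T x) hSS
  have aCC : ∀ x, C (C x) = x - K x := fun x => congrArg (fun T : H →L[ℂ] H => T x) hCC
  have aSC : ∀ x, S (C x) = C (S x) := fun x => congrArg (fun T : H →L[ℂ] H => T x) hcomm.eq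
  have hSinj : ∀ x, S x = 0 → x = 0 := by
    intro x hx
    have h1 : R (star R x) = 0 := by
      change K x = 0
      rw [← aSS, hx, map_zero]
    have h2 : star R x = 0 := by
      have h := hR1 (star R x)
      rw [h1, smul_zero, add_zero] at h
      exact LinearPMap.graph_fst_eq_zero_snd A h rfl
    have h := hR2 x
    rw [h2, smul_zero, sub_zero] at h
    exact LinearPMap.graph_fst_eq_zero_snd A h rfl
  have hSker : LinearMap.ker S.toLinearMap = ⊥ := LinearMap.ker_eq_bot'.2 hSinj
  let e := LinearEquiv.ofInjective S.toLinearMap (LinearMap.ker_eq_bot.1 hSker)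
  let P : H →ₗ.[ℂ] H := ⟨LinearMap.range S.toLinearMap, C.toLinearMap ∘ₗ e.symm.toLinearMap⟩
  have hPg : ∀ x y, (x, y) ∈ P.graph ↔ ∃ u, S u = x ∧ C u = y := by
    intro x y
    rw [LinearPMap.mem_graph_iff]
    constructor
    · rintro ⟨a, h1, h2⟩
      refine ⟨e.symm a, ?_, h2⟩
      simp only at h1
      rw [← h1]
      exact congrArg Subtype.val (e.apply_symm_apply a)
    · rintro ⟨u, h1, h2⟩
      refine ⟨e u, h1, ?_⟩
      rw [← h2]
      exact congrArg C (e.symm_apply_apply u)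
  have hPe : ∀ a : P.domain, ∃ u, S u = a ∧ C u = P a := fun a =>
    (hPg _ _).1 (LinearPMap.mem_graph P a)
  refine ⟨P, isSelfAdjoint_of_symmetric ?_ ?_ ?_, ?_, ?_⟩
  · change Dense (LinearMap.range S.toLinearMap : Set H)
    rw [Submodule.dense_iff_topologicalClosure_eq_top,
      Submodule.topologicalClosure_eq_top_iff, Submodule.eq_bot_iff]
    intro y hy
    apply hSinj
    have := (Submodule.mem_orthogonal _ _).1 hy (S (S y)) ⟨S y, rfl⟩
    rw [hSsa] at this
    exact inner_self_eq_zero.1 this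
  · intro x y
    obtain ⟨u, h1, h2⟩ := hPe x
    obtain ⟨v, h3, h4⟩ := hPe y
    rw [← h1, ← h2, ← h3, ← h4, hCsa, hSsa, aSC]
  · intro y w h
    rw [hPg]
    have h1 : C y = S w := by
      apply ext_inner_right ℂ
      intro u
      rw [hCsa, hSsa]
      have := h ⟨S u, ⟨u, rfl⟩⟩
      obtain ⟨v, h3, h4⟩ := hPe ⟨S u, ⟨u, rfl⟩⟩
      have hv : v = u := by
        apply sub_eq_zero.1
        apply hSinj
        rw [map_sub, h3, sub_self]
      rw [this, ← h4, hv]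
    refine ⟨S y + C w, ?_, ?_⟩
    · rw [map_add, aSC, ← h1, aSS, aCC]
      abel
    · rw [map_add, ← aSC, h1, aSS, aCC]
      abel
  · intro x
    obtain ⟨u, h1, h2⟩ := hPe x
    rw [← h1, ← h2, hSsa, aSC]
    exact ((ContinuousLinearMap.nonneg_iff_isPositive _).1 hCS0).re_inner_nonneg_right u
  · intro x y
    have key : SqRel P x y ↔ ∃ w, x = K w ∧ y = w - K w := by
      constructor
      · rintro ⟨z, h1, h2⟩
        obtain ⟨u, rfl, rfl⟩ := (hPg _ _).1 h1
        obtain ⟨v, h3, rfl⟩ := (hPg _ _).1 h2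
        have hu : u = S (S u + C v) := by
          rw [map_add, aSS, aSC, h3, aCC]
          abel
        refine ⟨S u + C v, ?_, ?_⟩
        · rw [← aSS, ← hu]
        · rw [← aSS, ← hu]
          abel
      · rintro ⟨w, rfl, rfl⟩
        refine ⟨C (S w), (hPg _ _).2 ⟨S w, aSS w, rfl⟩, (hPg _ _).2 ⟨C w, aSC w, aCC w⟩⟩
    rw [key]
    constructor
    · rintro ⟨w, rfl, rfl⟩
      exact hKA w
    · intro h
      have hx := hAK x y h
      exact ⟨x + y, hx, by rw [← hx]; abel⟩

/-- The absolute value `|A| = (A²)^{1/2}` of a self-adjoint operator: the positive self-adjoint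
operator `P` with `P² = A²` (the positive self-adjoint square root is unique). -/
def SA.abs (A : SA H) : SA H :=
  ⟨(exists_isAbs A.2).choose, (exists_isAbs A.2).choose_spec.1⟩

theorem SA.abs_spec (A : SA H) : IsAbs A.1 A.abs.1 := (exists_isAbs A.2).choose_spec

theorem SA.exists_inv_abs_add_one (A : SA H) :
    ∃ S : H →L[ℂ] H, IsBoundedInverse (addScalar A.abs.1 1) S := by
  have key : ∀ x : A.abs.1.domain, ‖(x : H)‖ ≤ ‖(1 : ℂ) • (x : H) + A.abs.1 x‖ := by
    intro x
    rw [one_smul]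
    refine le_of_sq_le_sq ?_ (norm_nonneg _)
    rw [norm_add_sq (𝕜 := ℂ), RCLike.re_to_complex]
    nlinarith [A.abs_spec.2.1 x, sq_nonneg ‖A.abs.1 x‖]
  apply exists_isBoundedInverse A.abs.2 1 key
  rw [star_one]
  exact key

/-- The bounded operator `(|A| + 1)⁻¹`. -/
def SA.invAbsAddOne (A : SA H) : H →L[ℂ] H := A.exists_inv_abs_add_one.choose

theorem SA.invAbsAddOne_spec (A : SA H) :
    IsBoundedInverse (addScalar A.abs.1 1) A.invAbsAddOne := A.exists_inv_abs_add_one.choose_spec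

/-- The number `⟨ξ, (|A| + 1)⁻² ξ⟩`. -/
def SA.form (A : SA H) (ξ : H) : ℝ := (⟪ξ, (A.invAbsAddOne ^ 2) ξ⟫_ℂ).re

/-! ### Diagonal operators -/

/-- The diagonal operator `∑ dₙ ⟨ηₙ, ·⟩ ηₙ` with respect to the orthonormal basis `η`, with its
maximal domain `{v : ∑ |dₙ ⟨ηₙ, v⟩|² < ∞}`. -/
def diagonalPMap (η : HilbertBasis ℕ ℂ H) (d : ℕ → ℝ) : H →ₗ.[ℂ] H where
  domain :=
    { carrier := {v | Memℓp (fun n => (d n : ℂ) * ⟪η n, v⟫_ℂ) 2}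
      zero_mem' := by
        have : (fun n => (d n : ℂ) * ⟪η n, (0 : H)⟫_ℂ) = 0 := by ext n; simp
        change Memℓp _ 2
        rw [this]
        exact zero_memℓp
      add_mem' := by
        intro a b ha hb
        have := Memℓp.add ha hb
        change Memℓp _ 2
        convert this using 1
        ext n
        simp [mul_add]
      smul_mem' := by
        intro c a ha
        have := Memℓp.const_smul ha c
        change Memℓp _ 2
        convert this using 1
        ext n
        simp
        ring }
  toFun :=
    { toFun := fun v => η.repr.symm ⟨fun n => (d n : ℂ) * ⟪η n, (v : H)⟫_ℂ, v.2⟩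
      map_add' := by
        intro a b
        rw [← map_add]
        congr 1
        ext n
        change _ = (d n : ℂ) * ⟪η n, (a : H)⟫_ℂ + (d n : ℂ) * ⟪η n, (b : H)⟫_ℂ
        rw [← mul_add, ← inner_add_right]
        rfl
      map_smul' := by
        intro c a
        rw [RingHom.id_apply, ← map_smul]
        congr 1
        ext n
        simp
        ring }

theorem inner_diagonalPMap (η : HilbertBasis ℕ ℂ H) (d : ℕ → ℝ) (v : (diagonalPMap η d).domain)
    (n : ℕ) : ⟪η n, diagonalPMap η d v⟫_ℂ = (d n : ℂ) * ⟪η n, (v : H)⟫_ℂ := by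
  rw [← HilbertBasis.repr_apply_apply]
  change (η.repr (η.repr.symm _)) n = _
  rw [LinearIsometryEquiv.apply_symm_apply]

theorem ext_hilbertBasis (η : HilbertBasis ℕ ℂ H) {v w : H} (h : ∀ n, ⟪η n, v⟫_ℂ = ⟪η n, w⟫_ℂ) :
    v = w := by
  apply η.repr.injective
  ext n
  rw [HilbertBasis.repr_apply_apply, HilbertBasis.repr_apply_apply, h]

theorem memℓp_inner (η : HilbertBasis ℕ ℂ H) (v : H) : Memℓp (fun n => ⟪η n, v⟫_ℂ) 2 := by
  have h : (fun n => ⟪η n, v⟫_ℂ) = fun n => η.repr v n :=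
    funext fun n => (HilbertBasis.repr_apply_apply η v n).symm
  rw [h]
  exact lp.memℓp (η.repr v)

theorem isSelfAdjoint_diagonalPMap (η : HilbertBasis ℕ ℂ H) (d : ℕ → ℝ) :
    IsSelfAdjoint (diagonalPMap η d) := by
  have hmem : ∀ m, η m ∈ (diagonalPMap η d).domain := by
    intro m
    have h := Memℓp.const_smul (memℓp_inner η (η m)) (d m : ℂ)
    change Memℓp _ 2
    convert h using 1
    ext n
    by_cases hn : n = m
    · subst hn; simp
    · simp [η.orthonormal.2 hn]
  have happ : ∀ m, diagonalPMap η d ⟨η m, hmem m⟩ = (d m : ℂ) • η m := by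
    intro m
    apply ext_hilbertBasis η
    intro n
    rw [inner_diagonalPMap, inner_smul_right]
    by_cases hn : n = m
    · subst hn; simp
    · simp [η.orthonormal.2 hn]
  apply isSelfAdjoint_of_symmetric
  · have h := η.dense_span
    rw [← Submodule.dense_iff_topologicalClosure_eq_top] at h
    refine h.mono ?_
    refine Submodule.span_le.2 ?_
    rintro _ ⟨m, rfl⟩
    exact hmem m
  · intro x y
    rw [← η.tsum_inner_mul_inner, ← η.tsum_inner_mul_inner]
    congr 1
    ext n
    rw [inner_diagonalPMap, ← inner_conj_symm, inner_diagonalPMap, map_mul, Complex.conj_ofReal,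
      inner_conj_symm]
    ring
  · intro y w h
    have hc : ∀ n, ⟪η n, w⟫_ℂ = (d n : ℂ) * ⟪η n, y⟫_ℂ := by
      intro n
      have := h ⟨η n, hmem n⟩
      rw [happ, inner_smul_right] at this
      rw [← inner_conj_symm, this, map_mul, Complex.conj_ofReal, inner_conj_symm]
    have hy : y ∈ (diagonalPMap η d).domain := by
      have := memℓp_inner η w
      simp only [hc] at this
      exact this
    refine (LinearPMap.mem_graph_iff _).2 ⟨⟨y, hy⟩, rfl, ?_⟩
    apply ext_hilbertBasis η
    intro n
    rw [inner_diagonalPMap, hc]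

/-- The diagonal operator with real entries `d`, as a self-adjoint operator. -/
def diagonal (η : HilbertBasis ℕ ℂ H) (d : ℕ → ℝ) : SA H :=
  ⟨diagonalPMap η d, isSelfAdjoint_diagonalPMap η d⟩

/-! ### Equivalence relations and reductions -/

/-- A countable union of closed sets. -/
def IsFσ {X : Type*} [TopologicalSpace X] (s : Set X) : Prop :=
  ∃ F : ℕ → Set X, (∀ n, IsClosed (F n)) ∧ s = ⋃ n, F n

/-- `f` is a continuous reduction of `E` to `F`. -/
def IsContinuousReduction {X Y : Type*} [TopologicalSpace X] [TopologicalSpace Y]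
    (E : Setoid X) (F : Setoid Y) (f : X → Y) : Prop :=
  Continuous f ∧ ∀ x y : X, E x y ↔ F (f x) (f y)

/-- `E ≤_c F`: `E` is continuously reducible to `F`. -/
def ContinuouslyReducible {X Y : Type*} [TopologicalSpace X] [TopologicalSpace Y]
    (E : Setoid X) (F : Setoid Y) : Prop :=
  ∃ f : X → Y, IsContinuousReduction E F f

/-- `E ∼_c F`: `E` and `F` are continuously bireducible. -/
def ContinuouslyBireducible {X Y : Type*} [TopologicalSpace X] [TopologicalSpace Y]
    (E : Setoid X) (F : Setoid Y) : Prop :=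
  ContinuouslyReducible E F ∧ ContinuouslyReducible F E

variable (H) in
/-- Equality of domains, as an equivalence relation on `SA H`. -/
def Edom : Setoid (SA H) where
  r A B := A.dom = B.dom
  iseqv := ⟨fun _ => rfl, fun h => h.symm, fun h k => h.trans k⟩

/-- The equivalence relation `sup_n |a n - b n| < ∞` on `ℝ^ℕ`. -/
def Elinfty : Setoid (ℕ → ℝ) where
  r a b := BddAbove (Set.range fun n => |a n - b n|)
  iseqv :=
    { refl := fun a => ⟨0, by rintro _ ⟨n, rfl⟩; simp⟩
      symm := by
        rintro a b ⟨C, hC⟩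
        refine ⟨C, ?_⟩
        rintro _ ⟨n, rfl⟩
        have := hC ⟨n, rfl⟩
        simpa only [abs_sub_comm] using this
      trans := by
        rintro a b c ⟨C, hC⟩ ⟨D, hD⟩
        refine ⟨C + D, ?_⟩
        rintro _ ⟨n, rfl⟩
        exact (abs_sub_le (a n) (b n) (c n)).trans (add_le_add (hC ⟨n, rfl⟩) (hD ⟨n, rfl⟩)) }

/-! ### The two explicit reductions -/

/-- The map `A ↦ (log ⟨ξₙ, (|A| + 1)⁻² ξₙ⟩)ₙ`. -/
def logForm (ξ : ℕ → H) (A : SA H) : ℕ → ℝ := fun n => Real.log (A.form (ξ n))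

/-- The sequence `x̃` of positive and negative parts of `x`, interleaved. Indices start at `0`, so
`(x̃ (2n), x̃ (2n+1))` is `(|x n|, 0)` if `x n ≥ 0` and `(0, |x n|)` if `x n < 0`. -/
def interleave (x : ℕ → ℝ) : ℕ → ℝ := fun k =>
  if Even k then (if 0 ≤ x (k / 2) then |x (k / 2)| else 0)
  else (if 0 ≤ x (k / 2) then 0 else |x (k / 2)|)

/-- The map sending `x` to the diagonal operator with entries `exp (x̃ₖ / 2) - 1`. -/
def expDiagonal (η : HilbertBasis ℕ ℂ H) (x : ℕ → ℝ) : SA H :=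
  diagonal η fun k => Real.exp (interleave x k / 2) - 1

end DomainEquivalence

end

open DomainEquivalence

noncomputable section
namespace DomainEquivalence

section Resolvent

variable {H : Type*} [NormedAddCommGroup H] [InnerProductSpace ℂ H] [CompleteSpace H]

open ContinuousLinearMap (adjoint_inner_left adjoint_inner_right star_eq_adjoint)

/-! ### The resolvent of a self-adjoint operator -/

/-! Everything is read off the resolvent R = (A - i)⁻¹, a normal contraction whose range is dom A.
By Douglas factorisation, dom A ⊆ dom B iff ‖R_A x‖ ≤ c ‖R_B x‖ for some c and all x; normality is
what allows R in place of its adjoint. For fixed c this is a closed condition on (A, B), so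
`SA.dom_eq_iff` gives the F_σ claim.

For the first reduction, ‖R x‖² = ⟨x, (A² + 1)⁻¹ x⟩, and t² + 1 ≤ (t + 1)² ≤ 2(t² + 1) for t ≥ 0
makes this comparable with ⟨x, (|A| + 1)⁻² x⟩. Hence equal domains means forms with bounded ratio,
which may be tested on a dense sequence; logarithms turn it into bounded difference. For continuity,
(|A| + 1)⁻¹ is a fixed continuous function of K = (A² + 1)⁻¹ = R*R (`SA.invAbsAddOne_eq_cfc`), and
both K and continuous functions of K depend strongly continuously on A (`continuous_cfc_apply`).

For the second reduction, the resolvent of a diagonal operator acts on η_n by (d_n - i)⁻¹, and two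
nonnegative diagonals d, e have the same domain iff (d_n + 1)/(e_n + 1) is bounded above and below.
Splitting x into positive and negative parts keeps the entries nonnegative and loses nothing.

Polishness: sampling R and R* on a dense sequence embeds SA(H) in (H × H)^ℕ with G_δ image
(`SA.range_resolventValues`), because a strong limit of resolvents and their adjoints is a resolvent
exactly when its range is dense (`exists_resolvent_eq`). -/

theorem IsBoundedInverse.apply_eq_of_mem_graph {T : H →ₗ.[ℂ] H} {z : ℂ} {R : H →L[ℂ] H}
    (hR : IsBoundedInverse (addScalar T z) R) {x y : H} (h : (x, y) ∈ T.graph) :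
    R (z • x + y) = x := by
  obtain ⟨u, rfl, rfl⟩ := (LinearPMap.mem_graph_iff _).1 h
  exact hR.2 u

theorem IsBoundedInverse.mem_graph {T : H →ₗ.[ℂ] H} {z : ℂ} {R : H →L[ℂ] H}
    (hR : IsBoundedInverse (addScalar T z) R) (x : H) : (R x, x - z • R x) ∈ T.graph := by
  obtain ⟨u, e1, e2⟩ := (LinearPMap.mem_graph_iff _).1 (hR.1 x)
  refine (LinearPMap.mem_graph_iff _).2 ⟨u, e1, ?_⟩
  have e2' : z • (u : H) + T u = x := e2
  simp only at e1
  rw [← e1, ← e2', add_sub_cancel_left]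

theorem mem_domain_of_mem_graph {T : H →ₗ.[ℂ] H} {x y : H} (h : (x, y) ∈ T.graph) :
    x ∈ T.domain := by
  obtain ⟨u, rfl, -⟩ := (LinearPMap.mem_graph_iff _).1 h
  exact u.2

theorem inner_eq_of_mem_graph {A : H →ₗ.[ℂ] H} (hA : IsSelfAdjoint A) {x y u v : H}
    (h : (x, y) ∈ A.graph) (k : (u, v) ∈ A.graph) : ⟪y, u⟫_ℂ = ⟪x, v⟫_ℂ := by
  obtain ⟨a, rfl, rfl⟩ := (LinearPMap.mem_graph_iff _).1 h
  obtain ⟨b, rfl, rfl⟩ := (LinearPMap.mem_graph_iff _).1 k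
  exact symmetric_of_isSelfAdjoint hA a b

namespace SA

variable (A : SA H)

theorem mem_graph_resolvent (x : H) :
    (A.resolvent x, x + Complex.I • A.resolvent x) ∈ A.1.graph := by
  have h := A.resolvent_spec.mem_graph x
  rwa [neg_smul, sub_neg_eq_add] at h

theorem resolvent_apply_of_mem_graph {x y : H} (h : (x, y) ∈ A.1.graph) :
    A.resolvent (y - Complex.I • x) = x := by
  have := A.resolvent_spec.apply_eq_of_mem_graph h
  rwa [neg_smul, neg_add_eq_sub] at this

theorem star_resolvent_apply_of_mem_graph {x y : H} (h : (x, y) ∈ A.1.graph) :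
    star A.resolvent (y + Complex.I • x) = x := by
  apply ext_inner_right ℂ
  intro v
  have := inner_eq_of_mem_graph A.2 h (A.mem_graph_resolvent v)
  rw [inner_add_right, inner_smul_right] at this
  rw [star_eq_adjoint, adjoint_inner_left, inner_add_left, inner_smul_left, this]
  simp

/-- The first resolvent identity for (A - i)⁻¹ and (A + i)⁻¹. Together with the version having the
factors in the other order it yields normality, and the pair characterises resolvents among
operators of dense range. -/
theorem resolvent_sub_star : A.resolvent - star A.resolvent =
    (2 * Complex.I) • (star A.resolvent * A.resolvent) := by
  ext x
  have h := A.star_resolvent_apply_of_mem_graph (A.mem_graph_resolvent x)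
  rw [map_add, map_add, map_smul] at h
  have h' : star A.resolvent x + Complex.I • star A.resolvent (A.resolvent x) +
    Complex.I • star A.resolvent (A.resolvent x) = A.resolvent x := h
  change A.resolvent x - star A.resolvent x =
    (2 * Complex.I) • star A.resolvent (A.resolvent x)
  nth_rewrite 1 [← h']
  module

theorem mem_graph_star_resolvent (x : H) :
    (star A.resolvent x, x - Complex.I • star A.resolvent x) ∈ A.1.graph := by
  apply mem_graph_of_isSelfAdjoint A.2
  intro y
  have h := A.resolvent_apply_of_mem_graph (LinearPMap.mem_graph A.1 y)
  have h2 : ⟪star A.resolvent x, A.1 y - Complex.I • (y : H)⟫_ℂ = ⟪x, (y : H)⟫_ℂ := by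
    rw [star_eq_adjoint, adjoint_inner_left, h]
  rw [inner_sub_right, inner_smul_right] at h2
  rw [inner_sub_left, inner_smul_left, ← h2]
  simp

theorem resolvent_sub_star' : A.resolvent - star A.resolvent =
    (2 * Complex.I) • (A.resolvent * star A.resolvent) := by
  ext x
  have h := A.resolvent_apply_of_mem_graph (A.mem_graph_star_resolvent x)
  rw [map_sub, map_sub, map_smul] at h
  change A.resolvent x - star A.resolvent x =
    (2 * Complex.I) • A.resolvent (star A.resolvent x)
  refine sub_eq_zero.1 (Eq.trans ?_ (sub_eq_zero.2 h))
  module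

theorem star_mul_resolvent :
    star A.resolvent * A.resolvent = A.resolvent * star A.resolvent := by
  have h := A.resolvent_sub_star.symm.trans A.resolvent_sub_star'
  exact smul_right_injective _ (mul_ne_zero two_ne_zero Complex.I_ne_zero) h

theorem norm_resolvent_le : ‖A.resolvent‖ ≤ 1 := by
  apply ContinuousLinearMap.opNorm_le_bound _ zero_le_one
  intro x
  obtain ⟨u, e1, e2⟩ := (LinearPMap.mem_graph_iff _).1 (A.resolvent_spec.1 x)
  have e2' : (-Complex.I) • (u : H) + A.1 u = x := e2
  simp only at e1
  have := A.norm_sq_add_I (-1) u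
  simp only [Complex.ofReal_neg, Complex.ofReal_one, neg_mul, one_mul] at this
  rw [← e1, ← e2', one_mul]
  refine le_of_sq_le_sq ?_ (norm_nonneg _)
  rw [this]
  nlinarith [sq_nonneg ‖A.1 u‖]

theorem norm_star_resolvent_le : ‖star A.resolvent‖ ≤ 1 := by
  rw [norm_star]
  exact A.norm_resolvent_le

theorem norm_sq_apply (T : H →L[ℂ] H) (x : H) : ((‖T x‖ ^ 2 : ℝ) : ℂ) = ⟪x, (star T * T) x⟫_ℂ := by
  change _ = ⟪x, star T (T x)⟫_ℂ
  rw [star_eq_adjoint, adjoint_inner_right, inner_self_eq_norm_sq_to_K]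
  simp

theorem norm_star_resolvent_apply (x : H) : ‖star A.resolvent x‖ = ‖A.resolvent x‖ := by
  have h1 := norm_sq_apply A.resolvent x
  have h2 := norm_sq_apply (star A.resolvent) x
  rw [star_star, ← star_mul_resolvent, ← h1] at h2
  exact (sq_eq_sq₀ (norm_nonneg _) (norm_nonneg _)).1 (Complex.ofReal_injective h2)

theorem mem_dom_iff {x : H} : x ∈ A.dom ↔ ∃ u, A.resolvent u = x := by
  constructor
  · intro h
    exact ⟨_, A.resolvent_apply_of_mem_graph (LinearPMap.mem_graph A.1 ⟨x, h⟩)⟩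
  · rintro ⟨u, rfl⟩
    exact mem_domain_of_mem_graph (A.mem_graph_resolvent u)

theorem resolvent_injective : Function.Injective A.resolvent := by
  rw [injective_iff_map_eq_zero]
  intro x hx
  have h := A.mem_graph_resolvent x
  rw [hx, smul_zero, add_zero] at h
  exact LinearPMap.graph_fst_eq_zero_snd _ h rfl

/-! ### Inclusion of domains -/

/-- The easy half of the Douglas factorisation lemma, for resolvents. -/
theorem dom_le_of_norm_resolvent_le {A B : SA H} {c : ℝ}
    (h : ∀ x, ‖A.resolvent x‖ ≤ c * ‖B.resolvent x‖) : A.dom ≤ B.dom := by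
  intro y hy
  obtain ⟨u, rfl⟩ := A.mem_dom_iff.1 hy
  -- Since B = B*, it is enough that z ↦ ⟨R_A u, B z⟩ is bounded on dom B. Put x = (B + i)z, so z =
  -- R_B* x; then |⟨R_A u, x⟩| ≤ ‖u‖ ‖R_A* x‖, and by normality ‖R_A* x‖ = ‖R_A x‖ ≤ |c| ‖R_B x‖ =
  -- |c| ‖z‖.
  have key : A.resolvent u ∈ B.1.adjoint.domain := by
    rw [LinearPMap.mem_adjoint_domain_iff]
    refine AddMonoidHomClass.continuous_of_bound _ (‖u‖ * (|c| * 1) + ‖A.resolvent u‖) ?_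
    intro z
    change ‖⟪A.resolvent u, B.1 z⟫_ℂ‖ ≤ _
    have hz := B.star_resolvent_apply_of_mem_graph (LinearPMap.mem_graph B.1 z)
    set x := B.1 z + Complex.I • (z : H) with hx
    have e : B.1 z = x - Complex.I • (z : H) := by rw [hx, add_sub_cancel_right]
    have b1 : ‖⟪A.resolvent u, x⟫_ℂ‖ ≤ ‖u‖ * (|c| * ‖(z : H)‖) := by
      rw [← adjoint_inner_right, ← star_eq_adjoint]
      refine (norm_inner_le_norm _ _).trans ?_
      gcongr
      rw [norm_star_resolvent_apply, ← hz, norm_star_resolvent_apply]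
      exact (h x).trans (by gcongr; exact le_abs_self c)
    have b2 : ‖⟪A.resolvent u, Complex.I • (z : H)⟫_ℂ‖ ≤ ‖A.resolvent u‖ * ‖(z : H)‖ := by
      refine (norm_inner_le_norm _ _).trans ?_
      rw [norm_smul, Complex.norm_I, one_mul]
    rw [e, inner_sub_right]
    refine (norm_sub_le _ _).trans ?_
    change _ ≤ _ * ‖(z : H)‖
    nlinarith
  rw [LinearPMap.isSelfAdjoint_def.1 B.2] at key
  exact key

/-- The other half of the Douglas factorisation lemma, for resolvents. -/
theorem exists_norm_resolvent_le_of_dom_le {A B : SA H} (h : A.dom ≤ B.dom) :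
    ∃ c : ℝ, ∀ x, ‖A.resolvent x‖ ≤ c * ‖B.resolvent x‖ := by
  have hmem : ∀ x, A.resolvent x ∈ B.1.domain := fun x => h (A.mem_dom_iff.2 ⟨x, rfl⟩)
  -- The factor (B - i) R_A is everywhere defined; its graph is closed because R_B is continuous and
  -- injective, so it is bounded. Taking adjoints in R_A = R_B L gives the estimate.
  let g : H →ₗ[ℂ] H := (addScalar B.1 (-Complex.I)).toFun ∘ₗ
    (A.resolvent.toLinearMap.codRestrict B.1.domain hmem)
  have hg : ∀ x, B.resolvent (g x) = A.resolvent x := fun x =>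
    B.resolvent_spec.2 ⟨A.resolvent x, hmem x⟩
  let L : H →L[ℂ] H := ContinuousLinearMap.ofSeqClosedGraph (g := g) (by
    intro u x y hu hy
    apply B.resolvent_injective
    rw [hg]
    refine tendsto_nhds_unique ((B.resolvent.continuous.tendsto y).comp hy) ?_
    have : B.resolvent ∘ g ∘ u = A.resolvent ∘ u := funext fun n => hg (u n)
    rw [this]
    exact (A.resolvent.continuous.tendsto x).comp hu)
  have hL : A.resolvent = B.resolvent * L := by
    ext x
    exact (hg x).symm
  refine ⟨‖star L‖, fun x => ?_⟩
  rw [← norm_star_resolvent_apply, hL, star_mul, ← B.norm_star_resolvent_apply]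
  exact (star L).le_opNorm _

theorem dom_eq_iff {A B : SA H} : A.dom = B.dom ↔ ∃ n : ℕ, ∀ x,
    ‖A.resolvent x‖ ≤ n * ‖B.resolvent x‖ ∧ ‖B.resolvent x‖ ≤ n * ‖A.resolvent x‖ := by
  constructor
  · intro h
    obtain ⟨c, hc⟩ := exists_norm_resolvent_le_of_dom_le h.le
    obtain ⟨d, hd⟩ := exists_norm_resolvent_le_of_dom_le h.ge
    obtain ⟨n, hn⟩ := exists_nat_ge (max c d)
    refine ⟨n, fun x => ⟨(hc x).trans ?_, (hd x).trans ?_⟩⟩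
    · gcongr
      exact (le_max_left c d).trans hn
    · gcongr
      exact (le_max_right c d).trans hn
  · rintro ⟨n, hn⟩
    exact le_antisymm (dom_le_of_norm_resolvent_le fun x => (hn x).1)
      (dom_le_of_norm_resolvent_le fun x => (hn x).2)

/-! ### Continuity in the strong resolvent topology -/

theorem continuous_iff_resolvent {X : Type*} [TopologicalSpace X] {f : X → SA H} :
    Continuous f ↔ ∀ v, Continuous fun x => (f x).resolvent v := by
  rw [continuous_induced_rng]
  constructor
  · intro h v
    exact (PointwiseConvergenceCLM.evalCLM (RingHom.id ℂ) H v).continuous.comp h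
  · intro h
    exact PointwiseConvergenceCLM.continuous_of_continuous_eval h

theorem continuous_resolvent (v : H) : Continuous fun A : SA H => A.resolvent v :=
  continuous_iff_resolvent.1 continuous_id v

/-- Taking adjoints is not strongly continuous in general. Here normality gives ‖R* v‖ = ‖R v‖, so
expanding ‖R_A* v - R_B* v‖² leaves only terms that are continuous in A through R_A. -/
theorem continuous_star_resolvent (v : H) : Continuous fun A : SA H => star A.resolvent v := by
  rw [continuous_iff_continuousAt]
  intro B
  have hexp : ∀ A : SA H, ‖star A.resolvent v - star B.resolvent v‖ ^ 2 =
      ‖A.resolvent v‖ ^ 2 - 2 * (⟪v, A.resolvent (star B.resolvent v)⟫_ℂ).re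
        + ‖B.resolvent v‖ ^ 2 := by
    intro A
    rw [norm_sub_sq (𝕜 := ℂ), norm_star_resolvent_apply, norm_star_resolvent_apply,
      star_eq_adjoint A.resolvent, adjoint_inner_left]
    rfl
  have h0 : Filter.Tendsto (fun A : SA H => ‖star A.resolvent v - star B.resolvent v‖ ^ 2)
      (𝓝 B) (𝓝 0) := by
    have hc : Continuous fun A : SA H => ‖star A.resolvent v - star B.resolvent v‖ ^ 2 := by
      simp only [hexp]
      have h1 := continuous_resolvent v
      have h2 := continuous_resolvent (star B.resolvent v)
      have h3 : Continuous fun A : SA H => ⟪v, A.resolvent (star B.resolvent v)⟫_ℂ :=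
        continuous_const.inner h2
      exact ((h1.norm.pow 2).sub (continuous_const.mul (Complex.continuous_re.comp h3))).add
        continuous_const
    have := hc.tendsto B
    simpa using this
  rw [ContinuousAt, tendsto_iff_norm_sub_tendsto_zero]
  have h1 := (Real.continuous_sqrt.tendsto 0).comp h0
  rw [Real.sqrt_zero] at h1
  refine h1.congr fun A => ?_
  simp [Real.sqrt_sq]

end SA

/-! ### Descriptive complexity of equality of domains. -/

theorem isFσ_Edom : IsFσ {p : SA H × SA H | Edom H p.1 p.2} := by
  refine ⟨fun n => {p | ∀ x, ‖p.1.resolvent x‖ ≤ n * ‖p.2.resolvent x‖ ∧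
    ‖p.2.resolvent x‖ ≤ n * ‖p.1.resolvent x‖}, fun n => ?_, ?_⟩
  · simp only [Set.ofPred_forall, Set.ofPred_and]
    have h1 : ∀ x, Continuous fun p : SA H × SA H => ‖p.1.resolvent x‖ := fun x =>
      ((SA.continuous_resolvent x).comp continuous_fst).norm
    have h2 : ∀ x, Continuous fun p : SA H × SA H => ‖p.2.resolvent x‖ := fun x =>
      ((SA.continuous_resolvent x).comp continuous_snd).norm
    exact isClosed_iInter fun x => (isClosed_le (h1 x) (continuous_const.mul (h2 x))).inter
      (isClosed_le (h2 x) (continuous_const.mul (h1 x)))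
  · ext p
    rw [Set.mem_iUnion]
    exact SA.dom_eq_iff

end Resolvent

section AbsoluteValue

variable {H : Type*} [NormedAddCommGroup H] [InnerProductSpace ℂ H] [CompleteSpace H]

open ContinuousLinearMap (adjoint_inner_left adjoint_inner_right star_eq_adjoint)

/-! ### The operators `(A² + 1)⁻¹` and `(|A| + 1)⁻¹` -/

/-- The polynomial is s² + (1 - s)². With s = 1/(t + 1) one has 1/(t² + 1) = s²/(s² + (1 - s)²), so
it is the denominator when K is expressed through (|A| + 1)⁻¹. -/
theorem sq_add_sq_one_sub_pos (s : ℝ) : 0 < 1 - 2 * s + 2 * s ^ 2 := by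
  nlinarith [sq_nonneg (2 * s - 1)]

theorem continuous_sq_div : Continuous fun s : ℝ => s ^ 2 / (1 - 2 * s + 2 * s ^ 2) :=
  Continuous.div (by fun_prop) (by fun_prop) fun s => (sq_add_sq_one_sub_pos s).ne'

/-- The function `k ↦ 1 / (t + 1)`, where `t ≥ 0` is determined by `k = 1 / (t² + 1)`. -/
def invAbsFun (k : ℝ) : ℝ := √k / (√(1 - k) + √k)

theorem continuous_invAbsFun : Continuous invAbsFun := by
  refine Continuous.div (by fun_prop) (by fun_prop) fun k => ?_
  rcases lt_or_ge 0 k with h | h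
  · have := Real.sqrt_pos.2 h
    positivity
  · have := Real.sqrt_pos.2 (show 0 < 1 - k by linarith)
    positivity

theorem invAbsFun_sq_div {s : ℝ} (h0 : 0 ≤ s) (h1 : s ≤ 1) :
    invAbsFun (s ^ 2 / (1 - 2 * s + 2 * s ^ 2)) = s := by
  have hD := sq_add_sq_one_sub_pos s
  have e : 1 - s ^ 2 / (1 - 2 * s + 2 * s ^ 2) = (1 - s) ^ 2 / (1 - 2 * s + 2 * s ^ 2) := by
    rw [eq_div_iff hD.ne', sub_mul, div_mul_cancel₀ _ hD.ne']
    ring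
  rw [invAbsFun, e, Real.sqrt_div' _ hD.le, Real.sqrt_div' _ hD.le, Real.sqrt_sq h0,
    Real.sqrt_sq (by linarith), ← add_div, sub_add_cancel]
  rw [div_div_div_cancel_right₀ (Real.sqrt_pos.2 hD).ne', div_one]

namespace SA

variable (A : SA H)

/-- The bounded operator `(A² + 1)⁻¹`. -/
def invSqAddOne : H →L[ℂ] H := star A.resolvent * A.resolvent

theorem invSqAddOne_apply_of_sqRel {x y : H} (h : SqRel A.1 x y) :
    A.invSqAddOne (x + y) = x := by
  obtain ⟨z, h1, h2⟩ := h
  rw [invSqAddOne, star_mul_resolvent]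
  -- This is the factorisation A² + 1 = (A + i)(A - i): R* sends x + y to (A - i)x, and R sends that
  -- to x.
  have h3 := A.1.graph.sub_mem h2 (A.1.graph.smul_mem Complex.I h1)
  have e := A.star_resolvent_apply_of_mem_graph (x := z - Complex.I • x)
    (y := y - Complex.I • z) h3
  have e' : y - Complex.I • z + Complex.I • (z - Complex.I • x) = x + y := by
    rw [smul_sub, smul_smul, Complex.I_mul_I]
    module
  rw [e'] at e
  change A.resolvent (star A.resolvent (x + y)) = x
  rw [e, A.resolvent_apply_of_mem_graph h1]

theorem invSqAddOne_nonneg : 0 ≤ A.invSqAddOne := star_mul_self_nonneg _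

theorem norm_invSqAddOne_le : ‖A.invSqAddOne‖ ≤ 1 := by
  refine (norm_mul_le _ _).trans ?_
  exact mul_le_one₀ A.norm_star_resolvent_le (norm_nonneg _) A.norm_resolvent_le

theorem spectrum_subset_of_nonneg {T : H →L[ℂ] H} (h0 : 0 ≤ T) (h1 : ‖T‖ ≤ 1) :
    spectrum ℝ T ⊆ Set.Icc 0 1 := fun x hx => by
  have : Nontrivial (H →L[ℂ] H) := by
    by_contra hn
    have := not_nontrivial_iff_subsingleton.1 hn
    rw [spectrum.of_subsingleton] at hx
    exact hx
  refine ⟨spectrum_nonneg_of_nonneg h0 hx, ?_⟩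
  exact (le_abs_self x).trans ((spectrum.norm_le_norm_of_mem hx).trans h1)

theorem mem_graph_abs_invAbsAddOne (x : H) :
    (A.invAbsAddOne x, x - A.invAbsAddOne x) ∈ A.abs.1.graph := by
  have h := A.invAbsAddOne_spec.mem_graph x
  rwa [one_smul] at h

theorem invAbsAddOne_symm (x y : H) : ⟪A.invAbsAddOne x, y⟫_ℂ = ⟪x, A.invAbsAddOne y⟫_ℂ := by
  have h := inner_eq_of_mem_graph A.abs.2 (A.mem_graph_abs_invAbsAddOne x)
    (A.mem_graph_abs_invAbsAddOne y)
  rw [inner_sub_left, inner_sub_right] at h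
  linear_combination -h

theorem star_invAbsAddOne : star A.invAbsAddOne = A.invAbsAddOne := by
  ext x
  apply ext_inner_right ℂ
  intro y
  rw [star_eq_adjoint, adjoint_inner_left, invAbsAddOne_symm]

theorem invAbsAddOne_nonneg : 0 ≤ A.invAbsAddOne := by
  rw [ContinuousLinearMap.nonneg_iff_isPositive, ContinuousLinearMap.isPositive_def']
  refine ⟨A.star_invAbsAddOne, fun x => ?_⟩
  have h := A.mem_graph_abs_invAbsAddOne x
  obtain ⟨u, e1, e2⟩ := (LinearPMap.mem_graph_iff _).1 h
  simp only at e1 e2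
  have hp := A.abs_spec.2.1 u
  rw [e1, e2, inner_sub_right, Complex.sub_re] at hp
  have hs := inner_self_nonneg (𝕜 := ℂ) (x := A.invAbsAddOne x)
  rw [RCLike.re_to_complex] at hs
  rw [ContinuousLinearMap.reApplyInnerSelf_apply, RCLike.re_to_complex]
  linarith

theorem norm_invAbsAddOne_le : ‖A.invAbsAddOne‖ ≤ 1 := by
  apply ContinuousLinearMap.opNorm_le_bound _ zero_le_one
  intro x
  obtain ⟨u, e1, e2⟩ := (LinearPMap.mem_graph_iff _).1 (A.mem_graph_abs_invAbsAddOne x)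
  simp only at e1 e2
  have hp := A.abs_spec.2.1 u
  have e3 : x = (u : H) + A.abs.1 u := by rw [e1, e2, add_sub_cancel]
  rw [← e1, one_mul]
  refine le_of_sq_le_sq ?_ (norm_nonneg _)
  rw [e3, norm_add_sq (𝕜 := ℂ), RCLike.re_to_complex]
  nlinarith [sq_nonneg ‖A.abs.1 u‖]

theorem invAbsAddOne_injective : Function.Injective A.invAbsAddOne := by
  rw [injective_iff_map_eq_zero]
  intro x hx
  have h := A.mem_graph_abs_invAbsAddOne x
  rw [hx, sub_zero] at h
  exact LinearPMap.graph_fst_eq_zero_snd _ h rfl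

theorem form_eq_norm_sq (x : H) : A.form x = ‖A.invAbsAddOne x‖ ^ 2 := by
  have h := norm_sq_apply A.invAbsAddOne x
  rw [star_invAbsAddOne, ← sq] at h
  rw [form, ← h, Complex.ofReal_re]

theorem form_pos {x : H} (hx : x ≠ 0) : 0 < A.form x := by
  rw [form_eq_norm_sq]
  have : A.invAbsAddOne x ≠ 0 := fun h =>
    hx (A.invAbsAddOne_injective (h.trans (map_zero A.invAbsAddOne).symm))
  positivity

/-- Write S = (|A| + 1)⁻¹. Then |A|² S² = (1 - S)², so (|A|² + 1) S² = 1 - 2S + 2S². Applying K and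
using |A|² = A², domains included, gives the identity. -/
theorem invSqAddOne_mul :
    A.invSqAddOne * (1 - 2 * A.invAbsAddOne + 2 * A.invAbsAddOne ^ 2) = A.invAbsAddOne ^ 2 := by
  ext x
  set S := A.invAbsAddOne with hS
  have h1 : (S (S x), S x - S (S x)) ∈ A.abs.1.graph := A.mem_graph_abs_invAbsAddOne (S x)
  have h2 : (S x - S (S x), (x - S x) - (S x - S (S x))) ∈ A.abs.1.graph :=
    A.abs.1.graph.sub_mem (A.mem_graph_abs_invAbsAddOne x) h1
  have h := A.invSqAddOne_apply_of_sqRel ((A.abs_spec.2.2 _ _).1 ⟨_, h1, h2⟩)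
  have e : (1 - 2 * S + 2 * S ^ 2 : H →L[ℂ] H) x = S (S x) + ((x - S x) - (S x - S (S x))) := by
    simp only [two_mul, sq]
    change x - (S x + S x) + (S (S x) + S (S x)) = _
    abel
  change A.invSqAddOne ((1 - 2 * S + 2 * S ^ 2 : H →L[ℂ] H) x) = S (S x)
  rw [e, h]

theorem invSqAddOne_eq_cfc : A.invSqAddOne =
    cfc (fun s : ℝ => s ^ 2 / (1 - 2 * s + 2 * s ^ 2)) A.invAbsAddOne := by
  set S := A.invAbsAddOne with hS
  have hsa : IsSelfAdjoint S := A.star_invAbsAddOne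
  have hD : Continuous fun s : ℝ => 1 - 2 * s + 2 * s ^ 2 := by fun_prop
  have hi : Continuous fun s : ℝ => (1 - 2 * s + 2 * s ^ 2)⁻¹ :=
    hD.inv₀ fun s => (sq_add_sq_one_sub_pos s).ne'
  have e2 : cfc (fun s : ℝ => s ^ 2) S = S ^ 2 := cfc_pow_id S 2
  have e1 : cfc (fun s : ℝ => 1 - 2 * s + 2 * s ^ 2) S = 1 - 2 * S + 2 * S ^ 2 := by
    rw [cfc_add S (fun s : ℝ => 1 - 2 * s) (fun s : ℝ => 2 * s ^ 2),
      cfc_sub (fun _ : ℝ => (1 : ℝ)) (fun s : ℝ => 2 * s) S,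
      cfc_const_mul 2 (fun s : ℝ => s) S, cfc_const_mul 2 (fun s : ℝ => s ^ 2) S, e2,
      cfc_const_one ℝ S, cfc_id' ℝ S]
    simp only [two_smul, two_mul]
  have e3 : cfc (fun s : ℝ => 1 - 2 * s + 2 * s ^ 2) S *
      cfc (fun s : ℝ => (1 - 2 * s + 2 * s ^ 2)⁻¹) S = 1 := by
    rw [← cfc_mul _ _ S hD.continuousOn hi.continuousOn, ← cfc_const_one ℝ S]
    exact cfc_congr fun s _ => mul_inv_cancel₀ (sq_add_sq_one_sub_pos s).ne'
  calc A.invSqAddOne = A.invSqAddOne * (1 - 2 * S + 2 * S ^ 2) *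
        cfc (fun s : ℝ => (1 - 2 * s + 2 * s ^ 2)⁻¹) S := by rw [mul_assoc, ← e1, e3, mul_one]
    _ = cfc (fun s : ℝ => s ^ 2 / (1 - 2 * s + 2 * s ^ 2)) S := by
      simp only [div_eq_mul_inv]
      rw [invSqAddOne_mul, ← e2, ← cfc_mul _ _ S (by fun_prop) hi.continuousOn]

/-- Inverts, on the spectrum in [0, 1], the expression of K as a function of S. The point is that K
= R*R depends visibly continuously on A, whereas |A| was obtained by an abstract choice. -/
theorem invAbsAddOne_eq_cfc : A.invAbsAddOne = cfc invAbsFun A.invSqAddOne := by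
  have hsa : IsSelfAdjoint A.invAbsAddOne := A.star_invAbsAddOne
  rw [invSqAddOne_eq_cfc, ← cfc_comp' invAbsFun _ A.invAbsAddOne
    continuous_invAbsFun.continuousOn continuous_sq_div.continuousOn]
  nth_rewrite 1 [← cfc_id' ℝ A.invAbsAddOne]
  refine cfc_congr fun s hs => ?_
  obtain ⟨h0, h1⟩ := spectrum_subset_of_nonneg A.invAbsAddOne_nonneg A.norm_invAbsAddOne_le hs
  exact (invAbsFun_sq_div h0 h1).symm

theorem norm_sq_le_of_star_mul_le {S T : H →L[ℂ] H} (h : star S * S ≤ star T * T) (x : H) :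
    ‖S x‖ ^ 2 ≤ ‖T x‖ ^ 2 := by
  have h1 := ((ContinuousLinearMap.le_def _ _).1 h).re_inner_nonneg_right x
  rw [sub_apply, inner_sub_right, ← norm_sq_apply, ← norm_sq_apply,
    ← Complex.ofReal_sub, RCLike.re_to_complex, Complex.ofReal_re] at h1
  linarith

theorem form_le_norm_sq_resolvent (x : H) : A.form x ≤ ‖A.resolvent x‖ ^ 2 := by
  have hsa : IsSelfAdjoint A.invAbsAddOne := A.star_invAbsAddOne
  rw [form_eq_norm_sq]
  apply norm_sq_le_of_star_mul_le
  change _ ≤ A.invSqAddOne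
  rw [invSqAddOne_eq_cfc, star_invAbsAddOne, ← sq, ← cfc_pow_id (R := ℝ) A.invAbsAddOne 2]
  refine cfc_mono (fun s hs => ?_) (by fun_prop) continuous_sq_div.continuousOn
  obtain ⟨h0, h1⟩ := spectrum_subset_of_nonneg A.invAbsAddOne_nonneg A.norm_invAbsAddOne_le hs
  rw [le_div_iff₀ (sq_add_sq_one_sub_pos s)]
  -- The denominator is 1 - 2s(1 - s), at most 1 on [0, 1].
  nlinarith [mul_nonneg (sq_nonneg s) (mul_nonneg h0 (sub_nonneg.2 h1))]

theorem norm_sq_resolvent_le_form (x : H) : ‖A.resolvent x‖ ^ 2 ≤ 2 * A.form x := by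
  have hsa : IsSelfAdjoint A.invAbsAddOne := A.star_invAbsAddOne
  have h : A.invSqAddOne ≤ (2 : ℝ) • A.invAbsAddOne ^ 2 := by
    rw [invSqAddOne_eq_cfc, ← cfc_pow_id (R := ℝ) A.invAbsAddOne 2,
      ← cfc_const_mul 2 (fun s : ℝ => s ^ 2) A.invAbsAddOne]
    refine cfc_mono (fun s hs => ?_) continuous_sq_div.continuousOn (by fun_prop)
    rw [div_le_iff₀ (sq_add_sq_one_sub_pos s)]
    -- Twice the denominator is 1 + (2s - 1)², at least 1; hence the factor 2.
    nlinarith [mul_nonneg (sq_nonneg s) (sq_nonneg (2 * s - 1))]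
  have h1 := ((ContinuousLinearMap.le_def _ _).1 h).re_inner_nonneg_right x
  rw [sub_apply, inner_sub_right, invSqAddOne, ← norm_sq_apply,
    smul_apply, RCLike.re_to_complex, Complex.sub_re, Complex.ofReal_re,
    inner_smul_right_eq_smul, Complex.smul_re] at h1
  change 0 ≤ 2 * A.form x - _ at h1
  linarith

end SA

end AbsoluteValue

section StrongConvergence

variable {H : Type*} [NormedAddCommGroup H] [InnerProductSpace ℂ H]

open Filter

/-! ### Strongly convergent families of contractions -/

theorem norm_apply_le_of_norm_le_one {T : H →L[ℂ] H} (hT : ‖T‖ ≤ 1) (v : H) : ‖T v‖ ≤ ‖v‖ := by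
  simpa using T.le_of_opNorm_le hT v

theorem tendsto_apply_of_norm_le_one {ι : Type*} {l : Filter ι} {F : ι → H →L[ℂ] H}
    (hF : ∀ k, ‖F k‖ ≤ 1) {g : ι → H} {w z : H} (h : Tendsto (fun k => F k w) l (𝓝 z))
    (hg : Tendsto g l (𝓝 w)) : Tendsto (fun k => F k (g k)) l (𝓝 z) := by
  have h0 : Tendsto (fun k => F k (g k - w)) l (𝓝 0) := by
    refine squeeze_zero_norm (fun k => norm_apply_le_of_norm_le_one (hF k) _) ?_
    exact tendsto_iff_norm_sub_tendsto_zero.1 hg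
  have := h0.add h
  simpa [map_sub] using this

theorem isClosed_setOf_continuous_apply {X : Type*} [TopologicalSpace X] {F : X → H →L[ℂ] H}
    (hF : ∀ x, ‖F x‖ ≤ 1) : IsClosed {v | Continuous fun x => F x v} := by
  refine isClosed_of_closure_subset fun v hv => ?_
  refine continuous_of_uniform_approx_of_continuous fun u hu => ?_
  obtain ⟨ε, hε, hεu⟩ := Metric.mem_uniformity_dist.1 hu
  obtain ⟨w, hw, hvw⟩ := Metric.mem_closure_iff.1 hv ε hε
  refine ⟨fun x => F x w, hw, fun x => hεu ?_⟩
  rw [dist_eq_norm, ← map_sub]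
  refine (norm_apply_le_of_norm_le_one (hF x) _).trans_lt ?_
  rwa [← dist_eq_norm]

theorem continuous_apply_of_denseRange {X ι : Type*} [TopologicalSpace X] {F : X → H →L[ℂ] H}
    (hF : ∀ x, ‖F x‖ ≤ 1) {ξ : ι → H} (hξ : DenseRange ξ)
    (h : ∀ n, Continuous fun x => F x (ξ n)) (v : H) : Continuous fun x => F x v :=
  hξ.induction_on (p := fun v => Continuous fun x => F x v) v
    (isClosed_setOf_continuous_apply hF) h

theorem exists_tendsto_of_denseRange [CompleteSpace H] {ι : Type*} {F : ℕ → H →L[ℂ] H}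
    (hF : ∀ k, ‖F k‖ ≤ 1) {ξ : ι → H} (hξ : DenseRange ξ) {y : ι → H}
    (h : ∀ n, Tendsto (fun k => F k (ξ n)) atTop (𝓝 (y n))) :
    ∃ T : H →L[ℂ] H, ∀ v, Tendsto (fun k => F k v) atTop (𝓝 (T v)) := by
  have hc : ∀ v, CauchySeq fun k => F k v := by
    intro v
    rw [Metric.cauchySeq_iff]
    intro ε hε
    obtain ⟨n, hn⟩ := hξ.exists_dist_lt v (show 0 < ε / 3 by positivity)
    obtain ⟨N, hN⟩ := Metric.cauchySeq_iff.1 (h n).cauchySeq (ε / 3) (by positivity)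
    refine ⟨N, fun j hj k hk => ?_⟩
    have h1 : ∀ k, dist (F k v) (F k (ξ n)) < ε / 3 := fun k => by
      rw [dist_eq_norm, ← map_sub]
      refine (norm_apply_le_of_norm_le_one (hF k) _).trans_lt ?_
      rwa [← dist_eq_norm]
    have h2 := dist_triangle4_right (F j v) (F k v) (F j (ξ n)) (F k (ξ n))
    linarith [h1 j, h1 k, hN j hj k hk]
  choose f hf using fun v => cauchySeq_tendsto_of_complete (hc v)
  exact ⟨continuousLinearMapOfTendsto F (tendsto_pi_nhds.2 hf), hf⟩

/-- Multiplication is jointly strongly continuous on the unit ball, so powers and polynomials of F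
are strongly continuous. Weierstrass approximation on [0, 1], which contains every spectrum, is
uniform in x and passes this on to g. -/
theorem continuous_cfc_apply [CompleteSpace H] {X : Type*} [TopologicalSpace X]
    {F : X → H →L[ℂ] H} (h0 : ∀ x, 0 ≤ F x) (hF : ∀ x, ‖F x‖ ≤ 1)
    (h : ∀ v, Continuous fun x => F x v) {g : ℝ → ℝ} (hg : Continuous g) (v : H) :
    Continuous fun x => cfc g (F x) v := by
  have hpow : ∀ (n : ℕ) (v : H), Continuous fun x => (F x ^ n) v := by
    intro n
    induction n with
    | zero => exact fun v => continuous_const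
    | succ n ih =>
      intro v
      simp only [pow_succ']
      exact continuous_iff_continuousAt.2 fun x =>
        tendsto_apply_of_norm_le_one hF ((h _).tendsto x) ((ih v).tendsto x)
  have hpoly : ∀ p : Polynomial ℝ, Continuous fun x => Polynomial.aeval (F x) p v := by
    intro p
    induction p using Polynomial.induction_on' with
    | add p q hp hq =>
      simp only [map_add, add_apply]
      exact hp.add hq
    | monomial n a =>
      simp only [Polynomial.aeval_monomial, Algebra.algebraMap_eq_smul_one, smul_mul_assoc,
        one_mul, smul_apply]
      exact (hpow n v).const_smul a
  refine continuous_of_uniform_approx_of_continuous fun u hu => ?_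
  obtain ⟨ε, hε, hεu⟩ := Metric.mem_uniformity_dist.1 hu
  obtain ⟨p, hp⟩ := exists_polynomial_near_of_continuousOn 0 1 g hg.continuousOn
    (ε / (‖v‖ + 1)) (by positivity)
  refine ⟨_, hpoly p, fun x => hεu ?_⟩
  have hsa : IsSelfAdjoint (F x) := IsSelfAdjoint.of_nonneg (h0 x)
  have hn : ‖cfc g (F x) - Polynomial.aeval (F x) p‖ ≤ ε / (‖v‖ + 1) := by
    rw [← cfc_polynomial p (F x), ← cfc_sub g p.eval (F x) hg.continuousOn
      p.continuous.continuousOn]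
    refine norm_cfc_le (by positivity) fun s hs => ?_
    rw [Real.norm_eq_abs, abs_sub_comm]
    exact (hp s (SA.spectrum_subset_of_nonneg (h0 x) (hF x) hs)).le
  rw [dist_eq_norm, ← sub_apply]
  refine (ContinuousLinearMap.le_of_opNorm_le _ hn v).trans_lt ?_
  rw [div_mul_eq_mul_div, div_lt_iff₀ (by positivity)]
  nlinarith [norm_nonneg v]

end StrongConvergence

section Polish

/-! ### Polishness of the space of self-adjoint operators -/

/-- An intersection of open sets f n embeds diagonally in the Polish product ∏ f n, as the closed
set where all coordinates agree. -/
theorem _root_.IsGδ.polishSpace {X : Type*} [TopologicalSpace X] [PolishSpace X] {s : Set X}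
    (hs : IsGδ s) : PolishSpace s := by
  obtain ⟨f, hf, rfl⟩ := hs.eq_iInter_nat
  have (n : ℕ) : PolishSpace (f n) := (hf n).polishSpace
  let g : (⋂ n, f n : Set X) → ∀ n, f n := fun x n => ⟨x, Set.mem_iInter.1 x.2 n⟩
  have hg : Continuous g := by fun_prop
  have he : IsEmbedding g := IsEmbedding.of_comp hg
    (g := fun p : ∀ n, f n => (p 0 : X)) (by fun_prop) IsEmbedding.subtypeVal
  have hr : Set.range g = {p : ∀ n, f n | ∀ n, (p n : X) = p 0} := by
    ext p
    constructor
    · rintro ⟨x, rfl⟩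
      exact fun n => rfl
    · intro hp
      refine ⟨⟨p 0, Set.mem_iInter.2 fun n => hp n ▸ (p n).2⟩, ?_⟩
      ext n
      exact (hp n).symm
  refine IsClosedEmbedding.polishSpace ⟨he, ?_⟩
  rw [hr]
  simp only [Set.ofPred_forall]
  exact isClosed_iInter fun n => isClosed_eq (by fun_prop) (by fun_prop)

variable {H : Type*} [NormedAddCommGroup H] [InnerProductSpace ℂ H] [CompleteSpace H]

open ContinuousLinearMap (adjoint_inner_left adjoint_inner_right star_eq_adjoint)
open Filter

/-- The operator is R⁻¹ + i on the range of R. The identity `h1` gives ker R ⊆ ker R*, which is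
orthogonal to the range and so zero, and it also gives symmetry; `h2` gives maximality. -/
theorem exists_resolvent_eq {R : H →L[ℂ] H}
    (h1 : ∀ v, R v - star R v = (2 * Complex.I) • star R (R v))
    (h2 : ∀ v, R v - star R v = (2 * Complex.I) • R (star R v))
    (hd : DenseRange R) : ∃ A : SA H, A.resolvent = R := by
  have hinner : ∀ x y, ⟪star R x, y⟫_ℂ = ⟪x, R y⟫_ℂ := fun x y => by
    rw [star_eq_adjoint, adjoint_inner_left]
  have hinj : ∀ x, R x = 0 → x = 0 := by
    intro x hx
    have h3 : star R x = 0 := by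
      have := h1 x
      rwa [hx, map_zero, smul_zero, zero_sub, neg_eq_zero] at this
    refine hd.eq_zero_of_inner_left ℂ fun u => ?_
    rw [← hinner, h3, inner_zero_left]
  let e := LinearEquiv.ofInjective R.toLinearMap
    (LinearMap.ker_eq_bot.1 (LinearMap.ker_eq_bot'.2 hinj))
  let P : H →ₗ.[ℂ] H := ⟨LinearMap.range R.toLinearMap,
    (LinearMap.id + Complex.I • R.toLinearMap) ∘ₗ e.symm.toLinearMap⟩
  have hmem : ∀ u, R u ∈ P.domain := fun u => ⟨u, rfl⟩
  have hPR : ∀ u, P ⟨R u, hmem u⟩ = u + Complex.I • R u := fun u =>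
    congrArg (fun w => w + Complex.I • R w) (e.symm_apply_apply u)
  have hgraph : ∀ u, (R u, u + Complex.I • R u) ∈ P.graph := fun u =>
    (LinearPMap.mem_graph_iff _).2 ⟨⟨R u, hmem u⟩, rfl, hPR u⟩
  have hPsa : IsSelfAdjoint P := by
    refine isSelfAdjoint_of_symmetric hd ?_ ?_
    · rintro ⟨_, u, rfl⟩ ⟨_, v, rfl⟩
      change ⟪P ⟨R u, hmem u⟩, R v⟫_ℂ = ⟪R u, P ⟨R v, hmem v⟩⟫_ℂ
      rw [hPR, hPR, inner_add_left, inner_add_right, inner_smul_left, inner_smul_right,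
        Complex.conj_I, ← hinner u v]
      have h := congrArg (fun w => ⟪w, v⟫_ℂ) (h1 u)
      simp only [inner_sub_left, inner_smul_left, map_mul, Complex.conj_I, hinner (R u)] at h
      simp only [map_ofNat] at h
      linear_combination -h
    · intro y w h
      -- If (y, w) is in the graph of the adjoint, then y = R*(w + iy). The identity `h2` turns this
      -- into y = R(w - iy), placing y in the range of R.
      have h3 : star R w = y - Complex.I • star R y := by
        apply ext_inner_right ℂ
        intro u
        have := h ⟨R u, hmem u⟩
        rw [hPR, inner_add_right, inner_smul_right] at this
        rw [hinner, this, inner_sub_left, inner_smul_left, hinner]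
        simp
      have h4 : R (w - Complex.I • y) = y := by
        have e1 := h2 w
        have e2 := h2 y
        rw [h3, map_sub, map_smul] at e1
        have e3 : R (star R y) = (2 * Complex.I)⁻¹ • (R y - star R y) := by
          rw [e2, inv_smul_smul₀ (by simp)]
        rw [e3] at e1
        rw [map_sub, map_smul, sub_eq_iff_eq_add, sub_eq_iff_eq_add.1 e1]
        have h5 : (2 * Complex.I) * Complex.I * (2 * Complex.I)⁻¹ = Complex.I := by
          rw [mul_assoc, mul_comm Complex.I, ← mul_assoc, mul_inv_cancel₀ (by simp), one_mul]
        rw [smul_sub, smul_smul, smul_smul, h5]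
        module
      have := hgraph (w - Complex.I • y)
      rwa [h4, sub_add_cancel] at this
  refine ⟨⟨P, hPsa⟩, IsBoundedInverse.unique (SA.resolvent_spec _) ⟨fun x => ?_, ?_⟩⟩
  · refine (LinearPMap.mem_graph_iff _).2 ⟨⟨R x, hmem x⟩, rfl, ?_⟩
    change (-Complex.I) • R x + P ⟨R x, hmem x⟩ = x
    rw [hPR]
    module
  · rintro ⟨_, u, rfl⟩
    change R ((-Complex.I) • R u + P ⟨R u, hmem u⟩) = R u
    rw [hPR]
    congr 1
    module

/-! ### The embedding into a product space and its G_δ image. -/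

namespace SA

theorem resolvent_injective_left : Function.Injective (SA.resolvent : SA H → H →L[ℂ] H) := by
  have key : ∀ (A : SA H) (x y : H), (x, y) ∈ A.1.graph ↔
      A.resolvent (y - Complex.I • x) = x := by
    refine fun A x y => ⟨A.resolvent_apply_of_mem_graph, fun h => ?_⟩
    have := A.mem_graph_resolvent (y - Complex.I • x)
    rwa [h, sub_add_cancel] at this
  intro A B h
  apply Subtype.ext
  apply LinearPMap.eq_of_eq_graph
  ext ⟨x, y⟩
  rw [key, key, h]

theorem denseRange_resolvent (A : SA H) : DenseRange A.resolvent := by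
  have : Set.range A.resolvent = (A.1.domain : Set H) := by
    ext x
    exact A.mem_dom_iff.symm
  rw [DenseRange, this]
  exact A.2.dense_domain

/-- The values of the resolvent and of its adjoint along a sequence. -/
def resolventValues (ξ : ℕ → H) (A : SA H) (n : ℕ) : H × H :=
  (A.resolvent (ξ n), star A.resolvent (ξ n))

theorem isEmbedding_resolventValues {ξ : ℕ → H} (hξ : DenseRange ξ) :
    IsEmbedding (resolventValues ξ) := by
  refine ⟨⟨le_antisymm ?_ ?_⟩, ?_⟩
  · rw [← continuous_iff_le_induced]
    exact continuous_pi fun n => (continuous_resolvent _).prodMk (continuous_star_resolvent _)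
  · rw [← continuous_id_iff_le]
    let t : TopologicalSpace (SA H) := .induced (resolventValues ξ) inferInstance
    refine (@continuous_iff_resolvent H _ _ _ (SA H) t id).2 ?_
    refine @continuous_apply_of_denseRange H _ _ (SA H) ℕ t _ norm_resolvent_le ξ hξ fun n => ?_
    have h : @Continuous _ _ t _ (resolventValues ξ) := continuous_induced_dom
    exact (continuous_fst.comp (continuous_apply n)).comp h
  · intro A B h
    apply resolvent_injective_left
    apply DFunLike.coe_injective
    refine hξ.equalizer A.resolvent.continuous B.resolvent.continuous ?_
    funext n
    exact congrArg Prod.fst (congrFun h n)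

/-- At a point of the closure, R and R* converge strongly along a sequence and both resolvent
identities survive. Recording the adjoint values is what makes the adjoints converge strongly. Only
density of the range can fail in the limit (A = k·1 with k → ∞ gives R → 0), and the countable
intersection imposes it. -/
theorem range_resolventValues {ξ : ℕ → H} (hξ : DenseRange ξ) :
    Set.range (resolventValues ξ) = closure (Set.range (resolventValues ξ)) ∩
      ⋂ n : ℕ, ⋂ k : ℕ, ⋃ m : ℕ, {p | dist (ξ n) (p m).1 < 1 / ((k : ℝ) + 1)} := by
  refine Set.Subset.antisymm (Set.subset_inter subset_closure ?_) ?_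
  · rintro _ ⟨A, rfl⟩
    simp only [Set.mem_iInter, Set.mem_iUnion]
    intro n k
    exact (A.denseRange_resolvent.comp hξ A.resolvent.continuous).exists_dist_lt (ξ n)
      Nat.one_div_pos_of_nat
  · rintro p ⟨hp, hp'⟩
    simp only [Set.mem_iInter, Set.mem_iUnion] at hp'
    obtain ⟨q, hq, hqp⟩ := mem_closure_iff_seq_limit.1 hp
    choose A hA using hq
    obtain rfl : (fun k => resolventValues ξ (A k)) = q := funext hA
    have hlim := tendsto_pi_nhds.1 hqp
    have l1 : ∀ n, Tendsto (fun k => (A k).resolvent (ξ n)) atTop (𝓝 (p n).1) := fun n =>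
      (continuous_fst.tendsto _).comp (hlim n)
    have l2 : ∀ n, Tendsto (fun k => star (A k).resolvent (ξ n)) atTop (𝓝 (p n).2) := fun n =>
      (continuous_snd.tendsto _).comp (hlim n)
    obtain ⟨R, hR⟩ := exists_tendsto_of_denseRange (fun k => (A k).norm_resolvent_le) hξ l1
    obtain ⟨R', hR'⟩ := exists_tendsto_of_denseRange (fun k => (A k).norm_star_resolvent_le) hξ l2
    have hRp : ∀ n, R (ξ n) = (p n).1 := fun n => tendsto_nhds_unique (hR _) (l1 n)
    have hRp' : ∀ n, R' (ξ n) = (p n).2 := fun n => tendsto_nhds_unique (hR' _) (l2 n)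
    have hstar : R' = star R := by
      ext v
      apply ext_inner_right ℂ
      intro u
      rw [star_eq_adjoint, adjoint_inner_left]
      refine tendsto_nhds_unique ((hR' v).inner tendsto_const_nhds) ?_
      refine (tendsto_const_nhds.inner (hR u)).congr fun k => ?_
      rw [star_eq_adjoint, adjoint_inner_left]
    have h1 : ∀ v, R v - R' v = (2 * Complex.I) • R' (R v) := by
      intro v
      refine tendsto_nhds_unique ((hR v).sub (hR' v)) ?_
      refine ((tendsto_apply_of_norm_le_one (fun k => (A k).norm_star_resolvent_le) (hR' (R v))
        (hR v)).const_smul _).congr fun k => ?_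
      exact (congrArg (fun T : H →L[ℂ] H => T v) (A k).resolvent_sub_star).symm
    have h2 : ∀ v, R v - R' v = (2 * Complex.I) • R (R' v) := by
      intro v
      refine tendsto_nhds_unique ((hR v).sub (hR' v)) ?_
      refine ((tendsto_apply_of_norm_le_one (fun k => (A k).norm_resolvent_le) (hR (R' v))
        (hR' v)).const_smul _).congr fun k => ?_
      exact (congrArg (fun T : H →L[ℂ] H => T v) (A k).resolvent_sub_star').symm
    have hd : DenseRange R := by
      refine Dense.of_closure (hξ.mono ?_)
      rintro _ ⟨n, rfl⟩
      refine Metric.mem_closure_range_iff.2 fun ε hε => ?_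
      obtain ⟨k, hk⟩ := exists_nat_one_div_lt hε
      obtain ⟨m, hm⟩ := hp' n k
      exact ⟨ξ m, by rw [hRp]; exact hm.trans hk⟩
    subst hstar
    obtain ⟨B, rfl⟩ := exists_resolvent_eq h1 h2 hd
    exact ⟨B, funext fun n => Prod.ext (hRp n) (hRp' n)⟩

theorem polishSpace [TopologicalSpace.SeparableSpace H] : PolishSpace (SA H) := by
  have hξ := TopologicalSpace.denseRange_denseSeq H
  set ξ := TopologicalSpace.denseSeq H
  have hG : IsGδ (Set.range (resolventValues ξ)) := by
    rw [range_resolventValues hξ]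
    refine isClosed_closure.isGδ.inter (.iInter fun n => .iInter fun k => IsOpen.isGδ ?_)
    exact isOpen_iUnion fun m => isOpen_lt (by fun_prop) continuous_const
  have := hG.polishSpace
  exact (isEmbedding_resolventValues hξ).toHomeomorph.isClosedEmbedding.polishSpace

end SA

end Polish

section Reductions

variable {H : Type*} [NormedAddCommGroup H] [InnerProductSpace ℂ H] [CompleteSpace H]

/-! ### The reduction of `Edom` to `Elinfty` -/

theorem abs_log_sub_log_le {a b c : ℝ} (ha : 0 < a) (hb : 0 < b) (hc : 0 < c)
    (h1 : a ≤ c * b) (h2 : b ≤ c * a) : |Real.log a - Real.log b| ≤ Real.log c := by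
  have l1 := Real.log_le_log ha h1
  have l2 := Real.log_le_log hb h2
  rw [Real.log_mul hc.ne' hb.ne'] at l1
  rw [Real.log_mul hc.ne' ha.ne'] at l2
  rw [abs_le]
  constructor <;> linarith

namespace SA

theorem continuous_form (ξ : H) : Continuous fun A : SA H => A.form ξ := by
  have hK : ∀ v, Continuous fun A : SA H => A.invSqAddOne v := fun v =>
    continuous_iff_continuousAt.2 fun B =>
      tendsto_apply_of_norm_le_one norm_star_resolvent_le
        ((continuous_star_resolvent _).tendsto B) ((continuous_resolvent v).tendsto B)
  have h := continuous_cfc_apply invSqAddOne_nonneg norm_invSqAddOne_le hK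
    continuous_invAbsFun ξ
  simp only [← invAbsAddOne_eq_cfc] at h
  simp only [form_eq_norm_sq]
  exact h.norm.pow 2

theorem dom_le_of_form_le {A B : SA H} {ξ : ℕ → H} (hξ : DenseRange ξ) {c : ℝ}
    (h : ∀ n, A.form (ξ n) ≤ c * B.form (ξ n)) : A.dom ≤ B.dom := by
  -- From ‖R_A x‖² ≤ 2 form_A ≤ 2|c| form_B ≤ 2|c| ‖R_B x‖² on the dense sequence; both sides are
  -- continuous in x.
  apply dom_le_of_norm_resolvent_le (c := √(2 * |c|))
  intro x
  refine hξ.induction_on (p := fun x => ‖A.resolvent x‖ ≤ √(2 * |c|) * ‖B.resolvent x‖) x ?_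
    fun n => ?_
  · exact isClosed_le (by fun_prop) (by fun_prop)
  · refine le_of_sq_le_sq ?_ (by positivity)
    rw [mul_pow, Real.sq_sqrt (by positivity)]
    calc ‖A.resolvent (ξ n)‖ ^ 2 ≤ 2 * A.form (ξ n) := A.norm_sq_resolvent_le_form _
      _ ≤ 2 * (c * B.form (ξ n)) := by gcongr; exact h n
      _ ≤ 2 * (|c| * B.form (ξ n)) := by
        gcongr
        · rw [form_eq_norm_sq]
          positivity
        · exact le_abs_self c
      _ ≤ 2 * |c| * ‖B.resolvent (ξ n)‖ ^ 2 := by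
        rw [← mul_assoc]
        gcongr
        exact B.form_le_norm_sq_resolvent _

theorem exists_form_le_of_dom_eq {A B : SA H} (h : A.dom = B.dom) :
    ∃ c : ℝ, 0 < c ∧ ∀ x, A.form x ≤ c * B.form x ∧ B.form x ≤ c * A.form x := by
  obtain ⟨n, hn⟩ := dom_eq_iff.1 h
  have key : ∀ {A B : SA H} {x}, ‖A.resolvent x‖ ≤ n * ‖B.resolvent x‖ →
      A.form x ≤ (2 * (n : ℝ) ^ 2 + 1) * B.form x := by
    intro A B x h
    have hB : 0 ≤ B.form x := by
      rw [form_eq_norm_sq]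
      positivity
    calc A.form x ≤ ‖A.resolvent x‖ ^ 2 := A.form_le_norm_sq_resolvent x
      _ ≤ (n * ‖B.resolvent x‖) ^ 2 := by gcongr
      _ = (n : ℝ) ^ 2 * ‖B.resolvent x‖ ^ 2 := mul_pow _ _ _
      _ ≤ (n : ℝ) ^ 2 * (2 * B.form x) := by
        gcongr
        exact B.norm_sq_resolvent_le_form x
      _ ≤ _ := by linarith
  -- The added 1 keeps the constant positive even for n = 0, as taking its logarithm requires.
  exact ⟨2 * (n : ℝ) ^ 2 + 1, by positivity, fun x => ⟨key (hn x).1, key (hn x).2⟩⟩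

end SA

theorem isContinuousReduction_logForm {ξ : ℕ → H} (hξ : DenseRange ξ) (h0 : ∀ n, ξ n ≠ 0) :
    IsContinuousReduction (Edom H) Elinfty (logForm ξ) := by
  refine ⟨continuous_pi fun n => (SA.continuous_form (ξ n)).log fun A => (A.form_pos (h0 n)).ne',
    fun A B => ⟨fun h => ?_, ?_⟩⟩
  · obtain ⟨c, hc0, hc⟩ := SA.exists_form_le_of_dom_eq h
    refine ⟨Real.log c, ?_⟩
    rintro _ ⟨n, rfl⟩
    exact abs_log_sub_log_le (A.form_pos (h0 n)) (B.form_pos (h0 n)) hc0 (hc _).1 (hc _).2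
  · rintro ⟨C, hC⟩
    have key : ∀ {A B : SA H} {n}, Real.log (A.form (ξ n)) - Real.log (B.form (ξ n)) ≤ C →
        A.form (ξ n) ≤ Real.exp C * B.form (ξ n) := by
      intro A B n h
      rw [sub_le_iff_le_add] at h
      have := Real.exp_le_exp.2 h
      rwa [Real.exp_add, Real.exp_log (A.form_pos (h0 n)), Real.exp_log (B.form_pos (h0 n))]
        at this
    have h n : |Real.log (A.form (ξ n)) - Real.log (B.form (ξ n))| ≤ C := hC ⟨n, rfl⟩
    apply le_antisymm
    · exact SA.dom_le_of_form_le hξ fun n => key (abs_le.1 (h n)).2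
    · exact SA.dom_le_of_form_le hξ fun n => key (by linarith [(abs_le.1 (h n)).1])

/-! ### The reduction of `Elinfty` to `Edom` -/

theorem ofReal_sub_I_ne_zero (d : ℝ) : (d : ℂ) - Complex.I ≠ 0 := fun h => by
  simpa using congrArg Complex.im h

theorem resolvent_diagonal_apply (η : HilbertBasis ℕ ℂ H) (d : ℕ → ℝ) (n : ℕ) :
    (diagonal η d).resolvent (η n) = ((d n : ℂ) - Complex.I)⁻¹ • η n := by
  obtain ⟨u, e1, e2⟩ := (LinearPMap.mem_graph_iff _).1
    ((diagonal η d).mem_graph_resolvent (η n))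
  simp only at e1 e2
  apply ext_hilbertBasis η
  intro k
  have h : ⟪η k, (diagonal η d).1 u⟫_ℂ = (d k : ℂ) * ⟪η k, (u : H)⟫_ℂ :=
    inner_diagonalPMap η d u k
  rw [e2, e1, inner_add_right, inner_smul_right] at h
  rw [inner_smul_right]
  have h' : ((d k : ℂ) - Complex.I) * ⟪η k, (diagonal η d).resolvent (η n)⟫_ℂ = ⟪η k, η n⟫_ℂ := by
    linear_combination -h
  by_cases hk : k = n
  · subst hk
    rw [← h', inv_mul_cancel_left₀ (ofReal_sub_I_ne_zero _)]
  · rw [η.orthonormal.2 hk] at h' ⊢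
    rw [mul_zero]
    exact (mul_eq_zero.1 h').resolve_left (ofReal_sub_I_ne_zero _)

theorem norm_sq_ofReal_sub_I (d : ℝ) : ‖(d : ℂ) - Complex.I‖ ^ 2 = d ^ 2 + 1 := by
  rw [Complex.sq_norm, Complex.normSq_apply]
  simp
  ring

/-- The vectors on which the resolvent varies continuously form a closed subspace, by the uniform
contraction bound, and it contains every η_n. -/
theorem continuous_diagonal (η : HilbertBasis ℕ ℂ H) : Continuous (diagonal η) := by
  rw [SA.continuous_iff_resolvent]
  intro v
  have hclosed := isClosed_setOf_continuous_apply
    (F := fun d : ℕ → ℝ => (diagonal η d).resolvent) fun d => SA.norm_resolvent_le _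
  let V : Submodule ℂ H :=
    { carrier := {v | Continuous fun d : ℕ → ℝ => (diagonal η d).resolvent v}
      zero_mem' := by
        change Continuous _
        simp only [map_zero]
        exact continuous_const
      add_mem' := fun {a b} ha hb => by
        change Continuous _
        simp only [map_add]
        exact Continuous.add ha hb
      smul_mem' := fun c a ha => by
        change Continuous _
        simp only [map_smul]
        exact Continuous.const_smul ha c }
  have hV : Submodule.span ℂ (Set.range η) ≤ V := by
    rw [Submodule.span_le]
    rintro _ ⟨n, rfl⟩
    change Continuous fun d : ℕ → ℝ => (diagonal η d).resolvent (η n)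
    simp only [resolvent_diagonal_apply]
    refine Continuous.smul (Continuous.inv₀ ?_ fun d => ofReal_sub_I_ne_zero _) continuous_const
    fun_prop
  have htop := Submodule.topologicalClosure_minimal _ hV hclosed
  rw [η.dense_span] at htop
  exact htop (Submodule.mem_top (x := v))

theorem diagonal_dom_le_of_le (η : HilbertBasis ℕ ℂ H) {d e : ℕ → ℝ} {c : ℝ}
    (h : ∀ n, |d n| ≤ c * (|e n| + 1)) : (diagonal η e).dom ≤ (diagonal η d).dom := by
  intro v hv
  have hv' : Memℓp (fun n => (e n : ℂ) * ⟪η n, v⟫_ℂ) 2 := hv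
  change Memℓp (fun n => (d n : ℂ) * ⟪η n, v⟫_ℂ) 2
  have h2 : 0 < (2 : ENNReal).toReal := by norm_num
  have hw := memℓp_inner η v
  rw [memℓp_gen_iff h2] at hv' hw ⊢
  simp only [ENNReal.toReal_ofNat, Real.rpow_ofNat] at hv' hw ⊢
  refine Summable.of_nonneg_of_le (fun n => by positivity) (fun n => ?_)
    ((hv'.add hw).mul_left (2 * c ^ 2))
  rw [norm_mul, norm_mul, Complex.norm_real, Complex.norm_real, Real.norm_eq_abs,
    Real.norm_eq_abs]
  have h3 : |d n| * ‖⟪η n, v⟫_ℂ‖ ≤ c * (|e n| * ‖⟪η n, v⟫_ℂ‖ + ‖⟪η n, v⟫_ℂ‖) :=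
    (mul_le_mul_of_nonneg_right (h n) (norm_nonneg _)).trans_eq (by ring)
  calc (|d n| * ‖⟪η n, v⟫_ℂ‖) ^ 2
      ≤ (c * (|e n| * ‖⟪η n, v⟫_ℂ‖ + ‖⟪η n, v⟫_ℂ‖)) ^ 2 := by gcongr
    _ = c ^ 2 * (|e n| * ‖⟪η n, v⟫_ℂ‖ + ‖⟪η n, v⟫_ℂ‖) ^ 2 := mul_pow _ _ _
    _ ≤ c ^ 2 * (2 * ((|e n| * ‖⟪η n, v⟫_ℂ‖) ^ 2 + ‖⟪η n, v⟫_ℂ‖ ^ 2)) := by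
      gcongr
      exact add_sq_le
    _ = _ := by ring

/-- Evaluates the norm comparison of resolvents at η_n, where the squared norm is 1/(d_n² + 1). -/
theorem exists_le_of_diagonal_dom_eq (η : HilbertBasis ℕ ℂ H) {d e : ℕ → ℝ}
    (h : (diagonal η d).dom = (diagonal η e).dom) :
    ∃ c : ℝ, 0 < c ∧ ∀ n, e n ^ 2 + 1 ≤ c * (d n ^ 2 + 1) ∧ d n ^ 2 + 1 ≤ c * (e n ^ 2 + 1) := by
  obtain ⟨m, hm⟩ := SA.dom_eq_iff.1 h
  have hr (d : ℕ → ℝ) (n : ℕ) :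
      ‖(diagonal η d).resolvent (η n)‖ ^ 2 = (d n ^ 2 + 1)⁻¹ := by
    rw [resolvent_diagonal_apply, norm_smul, η.orthonormal.1, mul_one, norm_inv, inv_pow,
      norm_sq_ofReal_sub_I]
  have key : ∀ {d e : ℕ → ℝ} {n : ℕ}, ‖(diagonal η d).resolvent (η n)‖ ≤
      m * ‖(diagonal η e).resolvent (η n)‖ → e n ^ 2 + 1 ≤ ((m : ℝ) ^ 2 + 1) * (d n ^ 2 + 1) := by
    intro d e n h
    have h' := pow_le_pow_left₀ (norm_nonneg _) h 2
    rw [mul_pow, hr, hr, ← div_eq_mul_inv, inv_eq_one_div,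
      div_le_div_iff₀ (by positivity) (by positivity), one_mul] at h'
    nlinarith [sq_nonneg (d n)]
  exact ⟨(m : ℝ) ^ 2 + 1, by positivity, fun n => ⟨key (hm _).1, key (hm _).2⟩⟩

theorem interleave_eq (x : ℕ → ℝ) (k : ℕ) :
    interleave x k = if Even k then max (x (k / 2)) 0 else max (-x (k / 2)) 0 := by
  unfold interleave
  rcases le_total 0 (x (k / 2)) with h | h
  · simp [h, abs_of_nonneg]
  · rcases h.eq_or_lt with h' | h'
    · simp [h']
    · simp [h, not_le.2 h', abs_of_neg h']

theorem interleave_nonneg (x : ℕ → ℝ) (k : ℕ) : 0 ≤ interleave x k := by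
  rw [interleave_eq]
  split_ifs <;> exact le_max_right _ _

theorem interleave_sub_interleave_succ (x : ℕ → ℝ) (n : ℕ) :
    interleave x (2 * n) - interleave x (2 * n + 1) = x n := by
  have h : (2 * n + 1) / 2 = n := by omega
  rw [interleave_eq, interleave_eq, if_pos (even_two_mul n), if_neg (by simp), h,
    Nat.mul_div_cancel_left n two_pos]
  rcases le_total 0 (x n) with h | h <;> simp [h]

/-- Positive and negative parts are 1-Lipschitz functions of a real number. -/
theorem abs_interleave_sub_le (x y : ℕ → ℝ) (k : ℕ) :
    |interleave x k - interleave y k| ≤ |x (k / 2) - y (k / 2)| := by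
  rw [interleave_eq, interleave_eq]
  split_ifs
  · exact abs_max_sub_max_le_abs _ _ _
  · refine (abs_max_sub_max_le_abs _ _ _).trans_eq ?_
    rw [neg_sub_neg, abs_sub_comm]

theorem continuous_interleave (k : ℕ) : Continuous fun x => interleave x k := by
  simp only [interleave_eq]
  split_ifs <;> fun_prop

theorem isContinuousReduction_expDiagonal (η : HilbertBasis ℕ ℂ H) :
    IsContinuousReduction Elinfty (Edom H) (expDiagonal η) := by
  have hnn : ∀ x k, 0 ≤ Real.exp (interleave x k / 2) - 1 := fun x k => by
    have := Real.one_le_exp (div_nonneg (interleave_nonneg x k) two_pos.le)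
    linarith
  refine ⟨?_, fun x y => ⟨?_, fun h => ?_⟩⟩
  · refine (continuous_diagonal η).comp (continuous_pi fun k => ?_)
    have := continuous_interleave k
    fun_prop
  · rintro ⟨C, hC⟩
    have key : ∀ {x y : ℕ → ℝ}, (∀ n, |x n - y n| ≤ C) →
        (expDiagonal η y).dom ≤ (expDiagonal η x).dom := by
      intro x y h
      -- Each entry plus 1 equals exp(x̃/2), and x̃ - ỹ ≤ C.
      apply diagonal_dom_le_of_le η (c := Real.exp (C / 2))
      intro k
      rw [abs_of_nonneg (hnn x k), abs_of_nonneg (hnn y k), sub_add_cancel, ← Real.exp_add]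
      have h1 := (abs_le.1 ((abs_interleave_sub_le x y k).trans (h _))).2
      have : Real.exp (interleave x k / 2) ≤ Real.exp (C / 2 + interleave y k / 2) :=
        Real.exp_le_exp.2 (by linarith)
      linarith
    have h : ∀ n, |x n - y n| ≤ C := fun n => hC ⟨n, rfl⟩
    exact le_antisymm (key fun n => by rw [abs_sub_comm]; exact h n) (key h)
  · obtain ⟨c, hc0, hc⟩ := exists_le_of_diagonal_dom_eq η h
    have hexp : ∀ x k, Real.exp (interleave x k) = (Real.exp (interleave x k / 2) - 1 + 1) ^ 2 := by
      intro x k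
      rw [sub_add_cancel, ← Real.exp_nat_mul]
      congr 1
      push_cast
      ring
    -- Passes from s² + 1, seen by the resolvent, to (s + 1)² = exp x̃, at the cost of a factor 2.
    have hle : ∀ {s t : ℝ}, 0 ≤ s → 0 ≤ t → s ^ 2 + 1 ≤ c * (t ^ 2 + 1) →
        (s + 1) ^ 2 ≤ 2 * c * (t + 1) ^ 2 := by
      intro s t hs ht h
      calc (s + 1) ^ 2 ≤ 2 * (s ^ 2 + 1) := by nlinarith [sq_nonneg (s - 1)]
        _ ≤ 2 * (c * (t ^ 2 + 1)) := by gcongr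
        _ ≤ 2 * (c * (t + 1) ^ 2) := by
          gcongr
          nlinarith
        _ = _ := by ring
    have hb : ∀ k, |interleave x k - interleave y k| ≤ Real.log (2 * c) := by
      intro k
      have h1 := hle (hnn x k) (hnn y k) (hc k).2
      have h2 := hle (hnn y k) (hnn x k) (hc k).1
      rw [← hexp, ← hexp] at h1 h2
      have := abs_log_sub_log_le (Real.exp_pos _) (Real.exp_pos _) (by positivity) h1 h2
      rwa [Real.log_exp, Real.log_exp] at this
    -- x_n is the difference of its two interleaved entries, so the bound doubles.
    refine ⟨2 * Real.log (2 * c), ?_⟩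
    rintro _ ⟨n, rfl⟩
    simp only
    rw [← interleave_sub_interleave_succ x n, ← interleave_sub_interleave_succ y n,
      sub_sub_sub_comm]
    refine (abs_sub _ _).trans ?_
    linarith [hb (2 * n), hb (2 * n + 1)]

end Reductions

/-! ### Existence of the dense sequence and of a basis indexed by ℕ. -/

section Separable

variable {H : Type*} [NormedAddCommGroup H] [InnerProductSpace ℂ H]
  [TopologicalSpace.SeparableSpace H]

theorem exists_denseRange_ne_zero [Nontrivial H] : ∃ ξ : ℕ → H, DenseRange ξ ∧ ∀ n, ξ n ≠ 0 := by
  have := UniformSpace.secondCountable_of_separable H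
  have : Nonempty {x : H // x ≠ 0} := nonempty_subtype.2 (exists_ne 0)
  have hd : DenseRange (Subtype.val : {x : H // x ≠ 0} → H) := by
    have := Module.punctured_nhds_neBot ℂ H
    rw [denseRange_subtype_val]
    exact dense_compl_singleton 0
  exact ⟨_, hd.comp (TopologicalSpace.denseRange_denseSeq _) continuous_subtype_val,
    fun n => (TopologicalSpace.denseSeq {x : H // x ≠ 0} n).2⟩

/-- Distinct members are √2 apart, so balls of radius 1/2 around them are disjoint, and a separable
space holds only countably many. -/
theorem _root_.Orthonormal.countable {ι : Type*} {v : ι → H} (hv : Orthonormal ℂ v) :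
    Countable ι := by
  rw [← Set.countable_univ_iff]
  refine Set.PairwiseDisjoint.countable_of_isOpen (s := fun i => Metric.ball (v i) (1 / 2))
    ?_ (fun _ _ => Metric.isOpen_ball) fun i _ => Metric.nonempty_ball.2 (by norm_num)
  intro i _ j _ hij
  apply Metric.ball_disjoint_ball
  have h : ‖v i - v j‖ ^ 2 = 2 := by
    rw [norm_sub_sq (𝕜 := ℂ), hv.1, hv.1, hv.2 hij]
    norm_num
  rw [dist_eq_norm]
  nlinarith [norm_nonneg (v i - v j)]

theorem nonempty_hilbertBasis_nat [CompleteSpace H] (hH : ¬ FiniteDimensional ℂ H) :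
    Nonempty (HilbertBasis ℕ ℂ H) := by
  obtain ⟨w, b, -⟩ := exists_hilbertBasis ℂ H
  have := b.orthonormal.countable
  -- A finite basis has a finite-dimensional, hence closed, span, which would be all of H.
  have : Infinite w := by
    by_contra hfin
    rw [not_infinite_iff_finite] at hfin
    apply hH
    have hspan := b.dense_span
    have : FiniteDimensional ℂ (Submodule.span ℂ (Set.range b)) :=
      FiniteDimensional.span_of_finite ℂ (Set.finite_range b)
    rw [(Submodule.closed_of_finiteDimensional _).submodule_topologicalClosure_eq] at hspan
    rw [hspan] at this
    exact Module.Finite.equiv (Submodule.topEquiv (R := ℂ) (M := H))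
  obtain ⟨e⟩ := nonempty_equiv_of_countable (α := ℕ) (β := w)
  refine ⟨HilbertBasis.mk (v := b ∘ e) (b.orthonormal.comp e e.injective) ?_⟩
  rw [e.surjective.range_comp, b.dense_span]

end Separable

end DomainEquivalence

end

open DomainEquivalence
theorem theorem3p1 {H : Type*} [NormedAddCommGroup H] [InnerProductSpace ℂ H] [CompleteSpace H]
    [TopologicalSpace.SeparableSpace H] (hH : ¬ FiniteDimensional ℂ H) :
    PolishSpace (SA H) ∧
    IsFσ {p : SA H × SA H | Edom H p.1 p.2} ∧
    ContinuouslyBireducible (Edom H) Elinfty ∧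
    (∀ ξ : ℕ → H, DenseRange ξ → (∀ n, ξ n ≠ 0) →
      (∀ (A : SA H) (n : ℕ), 0 < A.form (ξ n)) ∧
      IsContinuousReduction (Edom H) Elinfty (logForm ξ)) ∧
    (∀ η : HilbertBasis ℕ ℂ H, IsContinuousReduction Elinfty (Edom H) (expDiagonal η)) := by
  have : Nontrivial H := by
    by_contra h
    rw [not_nontrivial_iff_subsingleton] at h
    exact hH inferInstance
  obtain ⟨ξ, hξ, hξ0⟩ := exists_denseRange_ne_zero (H := H)
  obtain ⟨η⟩ := nonempty_hilbertBasis_nat hH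
  exact ⟨SA.polishSpace, isFσ_Edom,
    ⟨⟨_, isContinuousReduction_logForm hξ hξ0⟩, ⟨_, isContinuousReduction_expDiagonal η⟩⟩,
    fun ξ hξ h0 => ⟨fun A n => A.form_pos (h0 n), isContinuousReduction_logForm hξ h0⟩,
    isContinuousReduction_expDiagonal⟩
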